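/- Conventions. A metric space $X$ is geodesic if any two of its points are joined by a geodesic segment, and homogeneous if its isometry group acts transitively on it. Write $|\alpha|\in[0,\infty]$ for the arc length of a loop $\alpha:\partial\mathbb D\to X$ (a continuous map from the unit circle). Partitions. A partition $P$ of the closed unit disc $\mathbb D\subset\mathbb R^2$ is a finite collection of closed (topological) discs $D_1,\dots,D_k$ in the plane with pairwise disjoint interiors such that $\mathbb D=\bigcup_i D_i$, $\partial\mathbb D=\partial(D_1\cup\dots\cup D_k)$ and $D_i\cap D_j=\partial D_i\cap\partial D_j$ for $i\ne j$. Its $1$-skeleton is $P^{(1)}=\bigcup_i\partial D_i$. A vertex of $P$ is a point $p\in P^{(1)}$ such that $U\cap P^{(1)}$ is not homeomorphic to an interval for any open set $U\ni p$. An edge of $P$ is an arc in $P^{(1)}$ that joins two vertices and meets the set of vertices only at its endpoints. A partition $\Pi$ of a loop $\gamma:\partial\mathbb D\to X$ in a geodesic space is a map from the set of vertices of a partition $P$ of $\mathbb D$ to $X$ that agrees with $\gamma$ at the vertices on $\partial\mathbb D$. Extend $\Pi$ to $P^{(1)}$ by $\gamma$ on $\partial\mathbb D$ and by a geodesic segment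 on each edge not contained in $\partial\mathbb D$. The mesh of $\Pi$ is $\max_i|\Pi(\partial D_i)|$, the largest arc length of a loop $\Pi|_{\partial D_i}$ (it does not depend on the chosen geodesic segments). $\Pi$ is a $\delta$-partition if its mesh is $<\delta$. Let $P(\gamma,\delta)\in\mathbb N\cup\{\infty\}$ be the minimal number $k$ of discs (pieces) in a $\delta$-partition of $\gamma$, and $\infty$ if there is none. Coarse loop divisibility. For $n\in\mathbb N$ put $$\vartheta(n)=\sup\bigl\{P(\alpha,|\alpha|/2)\ :\ \alpha\text{ a loop in }X,\ n-1<|\alpha|\le n\bigr\}.$$ Let $\omega$ be an ultrafilter on $\mathbb N$ and $d=(d_n)$ a sequence of positive reals that is $\omega$-divergent, i.e. $\{n: d_n>M\}\in\omega$ for every $M$. For $\varepsilon>0$, $X$ is $\varepsilon$-coarsely loop divisible with respect to $(\omega,d)$ if for every $\delta\in(0,\varepsilon)$ there are $A\in\omega$ and $K\in\mathbb N$ such that $\vartheta(m)\le K$ for every natural number $m\in\bigcup_{n\in A}[\delta d_n,\varepsilon d_n]$. Asymptotic cone. For a sequence $e=(e_n)$ in $X$, $\operatorname{Con}^\omega(X,e,d)$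 is the set of sequences $x=(x_n)$ in $X$ for which $\operatorname{dist}(x_n,e_n)/d_n$ is bounded for $\omega$-almost all $n$, with the metric $\operatorname{dist}(x,y)=\lim^\omega \operatorname{dist}(x_n,y_n)/d_n$, where sequences at distance $0$ are identified. Theorem. Let $X$ be a complete homogeneous geodesic metric space, $\omega$ an ultrafilter on $\mathbb N$, $d=(d_n)$ an $\omega$-divergent sequence of positive reals and $e=(e_n)$ a sequence in $X$. If for every $\varepsilon>0$ the space $X$ is not $\varepsilon$-coarsely loop divisible with respect to $(\omega,d)$, then the fundamental group of $\operatorname{Con}^\omega(X,e,d)$ (at any base point) is uncountable. -/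

import Mathlib

open Set Filter Topology
open scoped ENNReal

noncomputable section

/-! ### Geodesic and homogeneous spaces -/

/-- `g`, restricted to `[0, dist x y]`, is a geodesic from `x` to `y`. -/
def IsGeodesicSegment {X : Type*} [MetricSpace X] (g : ℝ → X) (x y : X) : Prop :=
  g 0 = x ∧ g (dist x y) = y ∧
    ∀ s ∈ Icc (0 : ℝ) (dist x y), ∀ t ∈ Icc (0 : ℝ) (dist x y), dist (g s) (g t) = |s - t|

/-- Any two points are joined by a geodesic. -/
def IsGeodesicSpace (X : Type*) [MetricSpace X] : Prop :=
  ∀ x y : X, ∃ g : ℝ → X, IsGeodesicSegment g x y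

/-- The isometry group acts transitively. -/
def IsHomogeneousSpace (X : Type*) [MetricSpace X] : Prop :=
  ∀ x y : X, ∃ f : X ≃ᵢ X, f x = y

/-- Arc length of a loop `f : ∂𝔻 → X`, an extended non-negative real. -/
def loopLength {X : Type*} [MetricSpace X] (f : Circle → X) : ℝ≥0∞ :=
  eVariationOn (fun t : ℝ => f (Circle.exp t)) (Icc 0 (2 * Real.pi))

/-! ### Partitions of the unit disc -/

/-- A partition of the closed unit disc of the plane `ℂ`: finitely many closed topological discs
with pairwise disjoint interiors whose union is the unit disc, any two of which meet only along
their boundaries. -/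
structure DiscPartition where
  /-- the number of discs -/
  card : ℕ
  /-- the discs -/
  disc : Fin card → Set ℂ
  isDisc : ∀ i, Nonempty (disc i ≃ₜ Metric.closedBall (0 : ℂ) 1)
  disjoint_interior : ∀ i j, i ≠ j → Disjoint (interior (disc i)) (interior (disc j))
  iUnion_disc : ⋃ i, disc i = Metric.closedBall (0 : ℂ) 1
  frontier_iUnion : frontier (⋃ i, disc i) = Metric.sphere (0 : ℂ) 1
  inter_disc : ∀ i j, i ≠ j → disc i ∩ disc j = frontier (disc i) ∩ frontier (disc j)

namespace DiscPartition

/-- The union of the boundaries of the discs (the 1-skeleton). -/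
def skeleton (P : DiscPartition) : Set ℂ := ⋃ i, frontier (P.disc i)

/-- The vertices: the points of the 1-skeleton without a neighbourhood in the 1-skeleton that is
homeomorphic to an interval of the real line. -/
def vertices (P : DiscPartition) : Set ℂ :=
  {p | p ∈ P.skeleton ∧ ∀ U : Set ℂ, IsOpen U → p ∈ U →
    ¬ ∃ I : Set ℝ, I.OrdConnected ∧ Nonempty (↥(U ∩ P.skeleton) ≃ₜ I)}

/-- `c`, restricted to `[0, 1]`, parametrizes an edge: it is an arc in the 1-skeleton that joins
two vertices and meets the set of vertices only at its endpoints. -/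
structure IsEdge (P : DiscPartition) (c : ℝ → ℂ) : Prop where
  continuousOn : ContinuousOn c (Icc 0 1)
  injOn : InjOn c (Icc 0 1)
  mapsTo : MapsTo c (Icc 0 1) P.skeleton
  start_mem : c 0 ∈ P.vertices
  end_mem : c 1 ∈ P.vertices
  notMem : ∀ t ∈ Ioo (0 : ℝ) 1, c t ∉ P.vertices

end DiscPartition

/-! ### Partitions of loops -/

/-- A partition of a loop `γ`: a map from the set of vertices of a partition of the unit disc that
agrees with `γ` at the vertices on the unit circle. -/
structure LoopPartition {X : Type*} [MetricSpace X] (γ : C(Circle, X)) where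
  /-- the underlying partition of the unit disc -/
  base : DiscPartition
  /-- the map on vertices -/
  map : base.vertices → X
  map_boundary : ∀ (v : base.vertices) (z : Circle), (z : ℂ) = v → map v = γ z

namespace LoopPartition

variable {X : Type*} [MetricSpace X] {γ : C(Circle, X)}

/-- `F`, restricted to the 1-skeleton, extends the partition: it is `γ` on the unit circle and maps
each edge that is not contained in the unit circle to a geodesic segment that joins the images of
its endpoints (traversed monotonically). -/
structure IsExtension (Q : LoopPartition γ) (F : ℂ → X) : Prop where
  eq_map : ∀ v : Q.base.vertices, F v = Q.map v
  eq_loop : ∀ z : Circle, F z = γ z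
  geodesic : ∀ c : ℝ → ℂ, Q.base.IsEdge c → ¬ MapsTo c (Icc 0 1) (Metric.sphere (0 : ℂ) 1) →
    ∃ (g : ℝ → X) (σ : ℝ → ℝ), IsGeodesicSegment g (F (c 0)) (F (c 1)) ∧
      ContinuousOn σ (Icc 0 1) ∧ MonotoneOn σ (Icc 0 1) ∧
      σ 0 = 0 ∧ σ 1 = dist (F (c 0)) (F (c 1)) ∧ ∀ t ∈ Icc (0 : ℝ) 1, F (c t) = g (σ t)

/-- Length of the `i`-th piece for the extension `F`: the arc length of `F` along the Jordan curve
that bounds the `i`-th disc. It is the same for all parametrizations `φ` of that curve by the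
circle. -/
def pieceLength (Q : LoopPartition γ) (F : ℂ → X) (i : Fin Q.base.card) : ℝ≥0∞ :=
  ⨅ (φ : C(Circle, ℂ)) (_ : Function.Injective φ) (_ : range φ = frontier (Q.base.disc i)),
    loopLength (fun z => F (φ z))

/-- The maximal length of a piece for the extension `F`. -/
def mesh (Q : LoopPartition γ) (F : ℂ → X) : ℝ≥0∞ := ⨆ i, Q.pieceLength F i

/-- `Q` is a `δ`-partition: its mesh is less than `δ`. The lengths of the geodesic edges do not
depend on the geodesics, so neither does the mesh depend on the extension. -/
def IsDeltaPartition (Q : LoopPartition γ) (δ : ℝ≥0∞) : Prop :=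
  ∃ F : ℂ → X, Q.IsExtension F ∧ Q.mesh F < δ

end LoopPartition

/-- The minimal number of pieces of a `δ`-partition of `γ`, and `⊤` if there is none. -/
def partitionNumber {X : Type*} [MetricSpace X] (γ : C(Circle, X)) (δ : ℝ≥0∞) : ℕ∞ :=
  ⨅ (Q : LoopPartition γ) (_ : Q.IsDeltaPartition δ), (Q.base.card : ℕ∞)

/-- The supremum of the minimal numbers of pieces of `|α| / 2`-partitions over all loops `α`
with `n - 1 < |α| ≤ n`. -/
def divisibility (X : Type*) [MetricSpace X] (n : ℕ) : ℕ∞ :=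
  ⨆ (α : C(Circle, X)) (_ : (n : ℝ≥0∞) < loopLength α + 1 ∧ loopLength α ≤ n),
    partitionNumber α (loopLength α / 2)

/-- An `ω`-divergent sequence of positive real numbers. -/
structure ScalingSequence (ω : Ultrafilter ℕ) where
  /-- the terms -/
  toFun : ℕ → ℝ
  pos : ∀ n, 0 < toFun n
  diverges : ∀ M : ℝ, ∀ᶠ n in (ω : Filter ℕ), M < toFun n

/-- `X` is `ε`-coarsely loop divisible with respect to `(ω, d)`. -/
def IsCoarselyLoopDivisible (X : Type*) [MetricSpace X] (ω : Ultrafilter ℕ)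
    (d : ScalingSequence ω) (ε : ℝ) : Prop :=
  ∀ δ : ℝ, 0 < δ → δ < ε → ∃ A ∈ ω, ∃ K : ℕ, ∀ n ∈ A, ∀ m : ℕ,
    δ * d.toFun n ≤ m → (m : ℝ) ≤ ε * d.toFun n → divisibility X m ≤ K

/-! ### Asymptotic cones -/

/-- The sequences in `X` at finite rescaled `ω`-distance from the observation sequence `e`. -/
def ConeSequence {X : Type*} [MetricSpace X] (ω : Ultrafilter ℕ) (d : ScalingSequence ω)
    (e : ℕ → X) : Type _ :=
  {x : ℕ → X // ∃ M : ℝ, ∀ᶠ n in (ω : Filter ℕ), dist (x n) (e n) / d.toFun n < M}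

namespace ConeSequence

variable {X : Type*} [MetricSpace X] {ω : Ultrafilter ℕ} {d : ScalingSequence ω} {e : ℕ → X}

/-- The rescaled distance `lim^ω dist (x n) (y n) / d n`. -/
def coneDist (x y : ConeSequence ω d e) : ℝ :=
  limUnder (ω : Filter ℕ) (fun n => dist (x.1 n) (y.1 n) / d.toFun n)

theorem tendsto_coneDist (x y : ConeSequence ω d e) :
    Tendsto (fun n => dist (x.1 n) (y.1 n) / d.toFun n) ω (𝓝 (coneDist x y)) := by
  obtain ⟨M, hM⟩ := x.2
  obtain ⟨N, hN⟩ := y.2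
  have h : ∀ᶠ n in (ω : Filter ℕ),
      dist (x.1 n) (y.1 n) / d.toFun n ∈ Icc (0 : ℝ) (M + N) := by
    filter_upwards [hM, hN] with n h1 h2
    have hd := d.pos n
    refine ⟨by positivity, ?_⟩
    have h3 : dist (x.1 n) (y.1 n) / d.toFun n
        ≤ dist (x.1 n) (e n) / d.toFun n + dist (y.1 n) (e n) / d.toFun n := by
      rw [← add_div]
      gcongr
      exact dist_triangle_right _ _ _
    linarith
  obtain ⟨a, -, ha⟩ := (isCompact_Icc (a := (0 : ℝ)) (b := M + N)).ultrafilter_le_nhds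
    (ω.map (fun n => dist (x.1 n) (y.1 n) / d.toFun n)) (by
      rw [Filter.le_principal_iff]
      exact h)
  exact tendsto_nhds_limUnder ⟨a, ha⟩

instance : PseudoMetricSpace (ConeSequence ω d e) where
  dist := coneDist
  dist_self x := by
    refine tendsto_nhds_unique (tendsto_coneDist x x) ?_
    simp
  dist_comm x y := by
    refine tendsto_nhds_unique (tendsto_coneDist x y) ?_
    simpa only [dist_comm] using tendsto_coneDist y x
  dist_triangle x y z := by
    refine le_of_tendsto_of_tendsto' (tendsto_coneDist x z)
      ((tendsto_coneDist x y).add (tendsto_coneDist y z)) fun n => ?_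
    have hd := d.pos n
    rw [← add_div]
    gcongr
    exact dist_triangle _ _ _

end ConeSequence

/-- The asymptotic cone of `X`: sequences at finite rescaled distance from `e`, modulo rescaled
distance zero, with the metric induced by the rescaled distance. -/
abbrev AsymptoticCone {X : Type*} [MetricSpace X] (ω : Ultrafilter ℕ) (d : ScalingSequence ω)
    (e : ℕ → X) : Type _ :=
  SeparationQuotient (ConeSequence ω d e)

end

/-!
Loops in a metric space are compared by a discrete form of homotopy. Two loops at `p` are *finely
homotopic* (`FinelyHomotopic`) if for every `δ > 0` they are joined by a finite chain of maps
`[0, 1] → Y` that are continuous up to `δ`, such that successive maps are uniformly `δ`-close.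
Homotopic loops are finely homotopic, and fine homotopy is compatible with concatenation. Unlike
homotopy it has two features that the proof needs: its classes are `Gδ` sets in the topology of
uniform convergence, and at each scale it is witnessed by a finite grid of points.

*Uncountability.* Suppose that arbitrarily close to `p` there are loops `g k` that are not finely
homotopic to a constant. Infinite products of loops, with the factor `g k` present or absent
according to the `k`-th bit, define a continuous map from the Cantor space to the loops at `p`. If
the fundamental group were countable, the Cantor space would be a union of countably many sets each
contained in a fine homotopy class, and by the Baire theorem some class, being a `Gδ`, would be
comeagre in a nonempty open set. Flipping one far bit is a homeomorphism that maps a point of this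
set back into it, so there would be two finely homotopic products that differ in one factor only;
cancelling the common factors contradicts the choice of `g k`. This is
`uncountable_fundamentalGroup_of_small_loops`.

*Small loops in the cone.* If `X` is not `ε`-coarsely loop divisible, there are loops `α n` in `X` of
length comparable to `d n`, and at most `ε * d n`, whose partition numbers tend to infinity along `ω`
(`exists_loops_of_not_isCoarselyLoopDivisible`). After a Lipschitz reparametrization, and a
translation by isometries to a prescribed base point, they converge to a loop in the cone. If that
loop were finely homotopic to a constant, a grid in the cone, of fixed size `M × N`, would lift to
grids in `X` for `ω`-almost all `n`, and these would partition `α n` into `M * N` pieces of less than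
half of its length (`exists_small_loop_not_finelyHomotopic`).

*From grids to partitions.* The partition of the disc is the image of the cells of the rectangle
`[0, M] × [0, N]` under a homeomorphism of the plane whose restriction to the perimeter prescribes
the parametrization of the loop. The vertices of this partition are the grid points other than the
corners of the rectangle, because a triod does not embed in the line; this is enough to identify the
edges inside the disc with the sides of the cells (`isEdge_gridPartition`), and so to compute the
lengths of the pieces (`partitionNumber_le_of_grid`).
-/

noncomputable section

/-! ### Reparametrization of rectifiable paths -/

/-- A rectifiable path of length `L > 0` becomes `1`-Lipschitz on `[0, 2 * L]` after a change of
parameter. The new parameter is the length function plus a linear term of total increase `L`, which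
makes it strictly monotone even where the path is constant, so that the change of parameter is a
homeomorphism. -/
theorem exists_orderIso_lipschitz_reparam {X : Type*} [MetricSpace X] {f : ℝ → X}
    (hf : Continuous f) {T : ℝ} (hT : 0 < T) (hfin : eVariationOn f (Icc 0 T) ≠ ⊤)
    (hpos : 0 < (eVariationOn f (Icc 0 T)).toReal) :
    ∃ θ : ℝ ≃o ℝ, θ 0 = 0 ∧ θ (2 * (eVariationOn f (Icc 0 T)).toReal) = T ∧
      ∀ s ∈ Icc 0 (2 * (eVariationOn f (Icc 0 T)).toReal),
      ∀ t ∈ Icc 0 (2 * (eVariationOn f (Icc 0 T)).toReal),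
        dist (f (θ s)) (f (θ t)) ≤ |s - t| := by
  set L := (eVariationOn f (Icc 0 T)).toReal with hL
  -- The path is extended by constants to the whole line.
  set q : ℝ → ℝ := fun t => max 0 (min T t) with hq
  have hqm : Monotone q := fun a b h => max_le_max le_rfl (min_le_min le_rfl h)
  have hqI : ∀ t, q t ∈ Icc 0 T := fun t => ⟨le_max_left _ _, max_le hT.le (min_le_left _ _)⟩
  have hqe : ∀ t ∈ Icc 0 T, q t = t := fun t ht => by
    simp only [hq]; rw [min_eq_right ht.2, max_eq_right ht.1]
  set F : ℝ → X := f ∘ q with hF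
  have hFc : Continuous F := hf.comp (by fun_prop)
  have hFb : BoundedVariationOn F univ :=
    ne_top_of_le_ne_top hfin
      (eVariationOn.comp_le_of_monotoneOn f q (hqm.monotoneOn _) fun t _ => hqI t)
  have hFl := hFb.locallyBoundedVariationOn
  set v := variationOnFromTo F univ 0 with hv
  have hvm : Monotone v := fun a b h =>
    variationOnFromTo.monotoneOn hFl (mem_univ 0) (mem_univ a) (mem_univ b) h
  have hv0 : v 0 = 0 := variationOnFromTo.self _ _ _
  have hvT : v T = L := by
    rw [hv, variationOnFromTo.eq_of_le _ _ hT.le, univ_inter, hL]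
    congr 1
    exact eVariationOn.congr fun t ht => by simp [hF, hqe t ht]
  have hsub : ∀ a b, a ≤ b → v b - v a = (eVariationOn F (Icc a b)).toReal := fun a b h => by
    rw [← univ_inter (Icc a b), ← variationOnFromTo.eq_of_le _ _ h, sub_eq_iff_eq_add', hv,
      variationOnFromTo.add hFl (mem_univ _) (mem_univ _) (mem_univ _)]
  have hvc : Continuous v := by
    rw [continuous_iff_continuousAt]
    intro x
    rw [continuousAt_iff_continuous_left_right]
    have h1 := hFb.tendsto_eVariationOn_Icc_zero_left (x := x) hFc.continuousWithinAt
    have h2 := hFb.tendsto_eVariationOn_Icc_zero_right x hFc.continuousWithinAt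
    simp only [univ_inter, nhdsWithin_univ] at h1 h2
    have h1' := (ENNReal.tendsto_toReal ENNReal.zero_ne_top).comp h1
    have h2' := (ENNReal.tendsto_toReal ENNReal.zero_ne_top).comp h2
    constructor
    · have := (tendsto_const_nhds (x := v x)).sub (h1'.mono_left (nhdsWithin_le_nhds (s := Iic x)))
      simp only [ENNReal.toReal_zero, sub_zero] at this
      refine this.congr' ?_
      filter_upwards [self_mem_nhdsWithin] with y hy
      have := hsub y x hy
      simp only [Function.comp]; linarith
    · have := (tendsto_const_nhds (x := v x)).add (h2'.mono_left (nhdsWithin_le_nhds (s := Ici x)))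
      simp only [ENNReal.toReal_zero, add_zero] at this
      refine this.congr' ?_
      filter_upwards [self_mem_nhdsWithin] with y hy
      have := hsub x y hy
      simp only [Function.comp]; linarith
  set C := (eVariationOn F univ).toReal
  have hvC : ∀ t, |v t| ≤ C := fun t => variationOnFromTo.abs_le_eVariationOn hFb
  have hl : 0 < L / T := div_pos hpos hT
  -- The linear term makes the length function strictly monotone.
  set φ : ℝ → ℝ := fun t => v t + L / T * t with hφ
  have hφm : StrictMono φ := hvm.add_strictMono fun a b h => by simpa using (mul_lt_mul_iff_right₀ hl).2 h
  have hφc : Continuous φ := by fun_prop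
  have hφs : Function.Surjective φ := by
    refine hφc.surjective ?_ ?_
    · exact tendsto_atTop_add_left_of_le _ (-C) (fun t => (abs_le.1 (hvC t)).1)
        (tendsto_id.const_mul_atTop hl)
    · exact tendsto_atBot_add_left_of_ge _ C (fun t => (abs_le.1 (hvC t)).2)
        (tendsto_id.const_mul_atBot hl)
  set θ := (hφm.orderIsoOfSurjective φ hφs).symm with hθ
  have hφθ : ∀ s, φ (θ s) = s := fun s => (hφm.orderIsoOfSurjective φ hφs).apply_symm_apply s
  have hθφ : ∀ s, θ (φ s) = s := fun s => (hφm.orderIsoOfSurjective φ hφs).symm_apply_apply s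
  have h0 : φ 0 = 0 := by simp [hφ, hv0]
  have h1 : φ T = 2 * L := by simp only [hφ, hvT]; field_simp; ring
  have hθ0 : θ 0 = 0 := by rw [← h0, hθφ, h0]
  have hθT : θ (2 * L) = T := by rw [← h1, hθφ]
  have hFd : ∀ a b, a ≤ b → dist (F a) (F b) ≤ φ b - φ a := fun a b h => by
    have h3 : dist (F a) (F b) ≤ v b - v a := by
      rw [hsub a b h]
      exact BoundedVariationOn.dist_le (hFb.mono (subset_univ _)) (left_mem_Icc.2 h)
        (right_mem_Icc.2 h)
    have h4 : L / T * a ≤ L / T * b := by gcongr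
    simp only [hφ]; linarith
  have hfF : ∀ s ∈ Icc 0 (2 * L), f (θ s) = F (θ s) := fun s hs => by
    simp only [hF, Function.comp]
    rw [hqe]
    exact ⟨hθ0 ▸ θ.monotone hs.1, hθT ▸ θ.monotone hs.2⟩
  refine ⟨θ, hθ0, hθT, fun s hs t ht => ?_⟩
  rw [hfF s hs, hfF t ht]
  rcases le_total s t with h | h
  · have := hFd _ _ (θ.monotone h)
    rw [hφθ, hφθ] at this
    rw [abs_sub_comm]
    exact this.trans (le_abs_self _)
  · have := hFd _ _ (θ.monotone h)
    rw [hφθ, hφθ] at this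
    rw [dist_comm]
    exact this.trans (le_abs_self _)

/-! ### Loops, the perimeter of the square, and radial extensions -/

theorem exists_circle_exp_eq (z : Circle) : ∃ t ∈ Ico 0 (2 * Real.pi), Circle.exp t = z := by
  refine ⟨toIcoMod Real.two_pi_pos 0 (Complex.arg z),
    by simpa using toIcoMod_mem_Ico Real.two_pi_pos 0 (Complex.arg z), ?_⟩
  rw [toIcoMod, zsmul_eq_mul, Circle.periodic_exp.sub_int_mul_eq, Circle.exp_arg]

/-- A path over `[0, 2π]` with equal endpoints descends to the circle. -/
theorem exists_circle_lift {Z : Type*} [TopologicalSpace Z] {c : ℝ → Z}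
    (hc : ContinuousOn c (Icc 0 (2 * Real.pi))) (h0 : c 0 = c (2 * Real.pi)) :
    ∃ φ : C(Circle, Z), (∀ t ∈ Icc 0 (2 * Real.pi), φ (Circle.exp t) = c t) ∧
      range φ = c '' Icc 0 (2 * Real.pi) ∧
      (InjOn c (Ico 0 (2 * Real.pi)) → Function.Injective φ) := by
  have hT : (0 : ℝ) < 2 * Real.pi := Real.two_pi_pos
  have : Fact ((0 : ℝ) < 2 * Real.pi) := ⟨hT⟩
  let φ : C(Circle, Z) := ⟨fun z => AddCircle.liftIco (2 * Real.pi) 0 c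
    (AddCircle.homeomorphCircle'.symm z),
    (AddCircle.liftIco_zero_continuous h0 hc).comp AddCircle.homeomorphCircle'.symm.continuous⟩
  have e1 : ∀ t ∈ Ico 0 (2 * Real.pi), φ (Circle.exp t) = c t := fun t ht => by
    have : AddCircle.homeomorphCircle'.symm (Circle.exp t) = (t : AddCircle (2 * Real.pi)) := by
      rw [Homeomorph.symm_apply_eq]; rfl
    change AddCircle.liftIco (2 * Real.pi) 0 c (AddCircle.homeomorphCircle'.symm (Circle.exp t)) = _
    rw [this, AddCircle.liftIco_zero_coe_apply ht]
  have e2 : ∀ t ∈ Icc 0 (2 * Real.pi), φ (Circle.exp t) = c t := fun t ht => by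
    rcases ht.2.lt_or_eq with h | h
    · exact e1 t ⟨ht.1, h⟩
    · rw [h, ← h0, ← e1 0 ⟨le_rfl, hT⟩]; simp
  refine ⟨φ, e2, ?_, ?_⟩
  · ext y
    constructor
    · rintro ⟨z, rfl⟩
      obtain ⟨t, ht, rfl⟩ := exists_circle_exp_eq z
      exact ⟨t, Ico_subset_Icc_self ht, (e1 t ht).symm⟩
    · rintro ⟨t, ht, rfl⟩
      exact ⟨_, e2 t ht⟩
  · intro hi z w h
    obtain ⟨t, ht, rfl⟩ := exists_circle_exp_eq z
    obtain ⟨s, hs, rfl⟩ := exists_circle_exp_eq w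
    rw [e1 t ht, e1 s hs] at h
    rw [hi ht hs h]

/-- `s` clamped to `[0, 1]`. -/
def clamp (s : ℝ) : ℝ := max 0 (min 1 s)

/-- The perimeter of the unit square, run through counterclockwise from the origin as the parameter
goes from `0` to `4`, each side at unit speed. -/
def perimeter (t : ℝ) : ℝ × ℝ := (clamp t - clamp (t - 2), clamp (t - 1) - clamp (t - 3))

theorem clamp_of_le {s : ℝ} (h : s ≤ 0) : clamp s = 0 := by
  rw [clamp, min_eq_right (by linarith), max_eq_left h]

theorem clamp_of_mem {s : ℝ} (h0 : 0 ≤ s) (h1 : s ≤ 1) : clamp s = s := by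
  rw [clamp, min_eq_right h1, max_eq_right h0]

theorem clamp_of_ge {s : ℝ} (h : 1 ≤ s) : clamp s = 1 := by
  rw [clamp, min_eq_left h, max_eq_right zero_le_one]

theorem continuous_perimeter : Continuous perimeter := by
  unfold perimeter clamp; fun_prop

theorem perimeter_bottom {t : ℝ} (h0 : 0 ≤ t) (h1 : t ≤ 1) : perimeter t = (t, 0) := by
  rw [perimeter, clamp_of_mem h0 h1, clamp_of_le (s := t - 2) (by linarith),
    clamp_of_le (s := t - 1) (by linarith), clamp_of_le (s := t - 3) (by linarith)]
  simp

theorem perimeter_right {t : ℝ} (h0 : 1 ≤ t) (h1 : t ≤ 2) : perimeter t = (1, t - 1) := by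
  rw [perimeter, clamp_of_ge h0, clamp_of_le (s := t - 2) (by linarith),
    clamp_of_mem (s := t - 1) (by linarith) (by linarith), clamp_of_le (s := t - 3) (by linarith)]
  simp

theorem perimeter_top {t : ℝ} (h0 : 2 ≤ t) (h1 : t ≤ 3) : perimeter t = (3 - t, 1) := by
  rw [perimeter, clamp_of_ge (s := t) (by linarith),
    clamp_of_mem (s := t - 2) (by linarith) (by linarith),
    clamp_of_ge (s := t - 1) (by linarith), clamp_of_le (s := t - 3) (by linarith)]
  ext <;> simp; ring

theorem perimeter_left {t : ℝ} (h0 : 3 ≤ t) (h1 : t ≤ 4) : perimeter t = (0, 4 - t) := by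
  rw [perimeter, clamp_of_ge (s := t) (by linarith), clamp_of_ge (s := t - 2) (by linarith),
    clamp_of_ge (s := t - 1) (by linarith), clamp_of_mem (s := t - 3) (by linarith) (by linarith)]
  ext <;> simp; ring

theorem perimeter_cases {t : ℝ} (ht : t ∈ Icc (0 : ℝ) 4) :
    (t ≤ 1 ∧ perimeter t = (t, 0)) ∨ (1 ≤ t ∧ t ≤ 2 ∧ perimeter t = (1, t - 1)) ∨
      (2 ≤ t ∧ t ≤ 3 ∧ perimeter t = (3 - t, 1)) ∨ (3 ≤ t ∧ perimeter t = (0, 4 - t)) := by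
  rcases le_total t 1 with t1 | t1
  · exact Or.inl ⟨t1, perimeter_bottom ht.1 t1⟩
  rcases le_total t 2 with t2 | t2
  · exact Or.inr (Or.inl ⟨t1, t2, perimeter_right t1 t2⟩)
  rcases le_total t 3 with t3 | t3
  · exact Or.inr (Or.inr (Or.inl ⟨t2, t3, perimeter_top t2 t3⟩))
  · exact Or.inr (Or.inr (Or.inr ⟨t3, perimeter_left t3 ht.2⟩))

theorem perimeter_injOn : InjOn perimeter (Ico 0 4) := by
  intro s hs t ht h
  have := hs.1; have := hs.2; have := ht.1; have := ht.2
  rcases perimeter_cases (Ico_subset_Icc_self hs) with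
    ⟨_, e⟩ | ⟨_, _, e⟩ | ⟨_, _, e⟩ | ⟨_, e⟩ <;>
  rcases perimeter_cases (Ico_subset_Icc_self ht) with
    ⟨_, e'⟩ | ⟨_, _, e'⟩ | ⟨_, _, e'⟩ | ⟨_, e'⟩ <;>
  · rw [e, e'] at h
    obtain ⟨ha, hb⟩ := Prod.mk_inj.1 h
    linarith

theorem image_perimeter :
    perimeter '' Icc 0 4 = frontier (Icc (0 : ℝ) 1 ×ˢ Icc (0 : ℝ) 1) := by
  rw [frontier_prod_eq, frontier_Icc zero_le_one, closure_Icc]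
  ext ⟨x, y⟩
  simp only [mem_image, mem_union, mem_prod, mem_insert_iff, mem_singleton_iff, mem_Icc]
  constructor
  · rintro ⟨t, ht, h⟩
    have := ht.1; have := ht.2
    rcases perimeter_cases ht with ⟨_, e⟩ | ⟨_, _, e⟩ | ⟨_, _, e⟩ | ⟨_, e⟩ <;>
    · rw [e] at h
      obtain ⟨rfl, rfl⟩ := Prod.mk_inj.1 h
      first
      | exact Or.inl ⟨⟨by linarith, by linarith⟩, Or.inl rfl⟩
      | exact Or.inl ⟨⟨by linarith, by linarith⟩, Or.inr rfl⟩
      | exact Or.inr ⟨Or.inl rfl, by linarith, by linarith⟩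
      | exact Or.inr ⟨Or.inr rfl, by linarith, by linarith⟩
  · rintro (⟨⟨h0, h1⟩, rfl | rfl⟩ | ⟨rfl | rfl, h0, h1⟩)
    · exact ⟨x, ⟨h0, by linarith⟩, perimeter_bottom h0 h1⟩
    · refine ⟨3 - x, ⟨by linarith, by linarith⟩, ?_⟩
      rw [perimeter_top (by linarith) (by linarith)]; simp
    · refine ⟨4 - y, ⟨by linarith, by linarith⟩, ?_⟩
      rw [perimeter_left (by linarith) (by linarith)]; simp
    · refine ⟨y + 1, ⟨by linarith, by linarith⟩, ?_⟩
      rw [perimeter_right (by linarith) (by linarith)]; simp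

/-- The radial extension `x ↦ ‖x‖ ψ(x / ‖x‖)` of a map between unit spheres. -/
def radialExtension {E F : Type*} [NormedAddCommGroup E] [NormedSpace ℝ E]
    [NormedAddCommGroup F] [NormedSpace ℝ F]
    (ψ : Metric.sphere (0 : E) 1 → Metric.sphere (0 : F) 1) (x : E) : F :=
  open Classical in
  if h : x = 0 then 0 else ‖x‖ • (ψ ⟨‖x‖⁻¹ • x, by
    rw [mem_sphere_zero_iff_norm, norm_smul, norm_inv, norm_norm,
      inv_mul_cancel₀ (norm_ne_zero_iff.2 h)]⟩ : F)

section radial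
variable {E F : Type*} [NormedAddCommGroup E] [NormedSpace ℝ E]
    [NormedAddCommGroup F] [NormedSpace ℝ F]

theorem norm_radialExtension (ψ : Metric.sphere (0 : E) 1 → Metric.sphere (0 : F) 1) (x : E) :
    ‖radialExtension ψ x‖ = ‖x‖ := by
  unfold radialExtension
  split_ifs with h
  · simp [h]
  · rw [norm_smul, norm_norm, norm_eq_of_mem_sphere, mul_one]

theorem continuous_radialExtension {ψ : Metric.sphere (0 : E) 1 → Metric.sphere (0 : F) 1}
    (hψ : Continuous ψ) : Continuous (radialExtension ψ) := by
  rw [continuous_iff_continuousAt]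
  intro x
  by_cases hx : x = 0
  · rw [hx, ContinuousAt]
    have h0 : radialExtension ψ 0 = 0 := by simp [radialExtension]
    rw [h0, tendsto_zero_iff_norm_tendsto_zero]
    simp only [norm_radialExtension]
    exact tendsto_norm_zero
  · have hop : IsOpen ({0}ᶜ : Set E) := isOpen_compl_singleton
    refine ContinuousOn.continuousAt ?_ (hop.mem_nhds hx)
    rw [continuousOn_iff_continuous_domRestrict]
    have : ({0}ᶜ : Set E).domRestrict (radialExtension ψ) = fun y : ({0}ᶜ : Set E) =>
        ‖(y : E)‖ • (ψ ⟨‖(y : E)‖⁻¹ • (y : E), by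
          rw [mem_sphere_zero_iff_norm, norm_smul, norm_inv, norm_norm,
            inv_mul_cancel₀ (norm_ne_zero_iff.2 y.2)]⟩ : F) := by
      ext y
      simp only [Set.domRestrict_apply, radialExtension]
      rw [dif_neg (show (y : E) ≠ 0 from y.2)]
    rw [this]
    refine continuous_subtype_val.norm.smul (continuous_subtype_val.comp (hψ.comp ?_))
    refine Continuous.subtype_mk ?_ _
    exact (continuous_subtype_val.norm.inv₀ fun y => norm_ne_zero_iff.2 y.2).smul
      continuous_subtype_val

theorem radialExtension_sphere (ψ : Metric.sphere (0 : E) 1 → Metric.sphere (0 : F) 1)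
    (u : Metric.sphere (0 : E) 1) : radialExtension ψ u = ψ u := by
  have hu : ‖(u : E)‖ = 1 := norm_eq_of_mem_sphere u
  have h : (u : E) ≠ 0 := fun h => by rw [h] at hu; simp at hu
  rw [radialExtension, dif_neg h]
  simp [hu]

theorem radialExtension_leftInverse {ψ : Metric.sphere (0 : E) 1 → Metric.sphere (0 : F) 1}
    {χ : Metric.sphere (0 : F) 1 → Metric.sphere (0 : E) 1} (h : Function.LeftInverse χ ψ) :
    Function.LeftInverse (radialExtension χ) (radialExtension ψ) := by
  intro x
  by_cases hx : x = 0
  · simp [radialExtension, hx]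
  · have hn := norm_radialExtension ψ x
    have hn0 := norm_ne_zero_iff.2 hx
    have hne : radialExtension ψ x ≠ 0 := by rw [← norm_ne_zero_iff, hn]; exact hn0
    rw [radialExtension, dif_neg hne]
    simp only [hn]
    simp only [radialExtension, dif_neg hx, smul_smul, inv_mul_cancel₀ hn0, one_smul,
      mul_inv_cancel₀ hn0, Subtype.coe_eta, h _]

/-- A homeomorphism between unit spheres extends radially to the whole spaces. -/
def radialHomeomorph (ψ : Metric.sphere (0 : E) 1 ≃ₜ Metric.sphere (0 : F) 1) : E ≃ₜ F where
  toFun := radialExtension ψ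
  invFun := radialExtension ψ.symm
  left_inv := radialExtension_leftInverse ψ.left_inv
  right_inv := radialExtension_leftInverse ψ.right_inv
  continuous_toFun := continuous_radialExtension ψ.continuous
  continuous_invFun := continuous_radialExtension ψ.symm.continuous

end radial

/-! ### Grid partitions of the disc -/

/-- The unit cell of the integer grid with lower left corner `(i, j)`. -/
def gridCell (i j : ℕ) : Set (ℝ × ℝ) := Icc (i : ℝ) (i + 1) ×ˢ Icc (j : ℝ) (j + 1)

/-- The rectangle `[0, M] × [0, N]`. -/
def gridRect (M N : ℕ) : Set (ℝ × ℝ) := Icc (0 : ℝ) M ×ˢ Icc (0 : ℝ) N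

/-- The union of the grid lines in the rectangle `[0, M] × [0, N]`. -/
def gridLines (M N : ℕ) : Set (ℝ × ℝ) :=
  {p | p ∈ gridRect M N ∧ ((∃ i : ℕ, p.1 = i) ∨ ∃ j : ℕ, p.2 = j)}

theorem frontier_gridCell (i j : ℕ) : frontier (gridCell i j) =
    Icc (i : ℝ) (i + 1) ×ˢ {(j : ℝ), (j : ℝ) + 1} ∪ {(i : ℝ), (i : ℝ) + 1} ×ˢ Icc (j : ℝ) (j + 1) := by
  rw [gridCell, frontier_prod_eq, frontier_Icc (by simp), frontier_Icc (by simp), closure_Icc,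
    closure_Icc]

theorem interior_gridCell (i j : ℕ) : interior (gridCell i j) =
    Ioo (i : ℝ) (i + 1) ×ˢ Ioo (j : ℝ) (j + 1) := by
  rw [gridCell, interior_prod_eq, interior_Icc, interior_Icc]

theorem interior_gridRect (M N : ℕ) : interior (gridRect M N) =
    Ioo (0 : ℝ) M ×ˢ Ioo (0 : ℝ) N := by
  rw [gridRect, interior_prod_eq, interior_Icc, interior_Icc]

theorem exists_nat_mem_Icc {M : ℕ} (hM : 0 < M) {x : ℝ} (hx : x ∈ Icc (0 : ℝ) M) :
    ∃ i < M, x ∈ Icc (i : ℝ) (i + 1) := by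
  rcases hx.2.lt_or_eq with h | h
  · exact ⟨⌊x⌋₊, (Nat.floor_lt hx.1).2 h, Nat.floor_le hx.1, (Nat.lt_floor_add_one x).le⟩
  · refine ⟨M - 1, by omega, ?_⟩
    rw [Nat.cast_sub (by omega), h]
    simp

theorem iUnion_gridCell {M N : ℕ} (hM : 0 < M) (hN : 0 < N) :
    ⋃ p : Fin M × Fin N, gridCell p.1 p.2 = gridRect M N := by
  ext ⟨x, y⟩
  simp only [mem_iUnion, gridCell, gridRect, mem_prod]
  constructor
  · rintro ⟨⟨i, j⟩, hx, hy⟩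
    have h1 : ((i : ℕ) : ℝ) + 1 ≤ M := by exact_mod_cast i.2
    have h2 : ((j : ℕ) : ℝ) + 1 ≤ N := by exact_mod_cast j.2
    exact ⟨⟨(Nat.cast_nonneg _).trans hx.1, hx.2.trans h1⟩,
      ⟨(Nat.cast_nonneg _).trans hy.1, hy.2.trans h2⟩⟩
  · rintro ⟨hx, hy⟩
    obtain ⟨i, hi, hxi⟩ := exists_nat_mem_Icc hM hx
    obtain ⟨j, hj, hyj⟩ := exists_nat_mem_Icc hN hy
    exact ⟨(⟨i, hi⟩, ⟨j, hj⟩), hxi, hyj⟩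

theorem iUnion_frontier_gridCell {M N : ℕ} (hM : 0 < M) (hN : 0 < N) :
    ⋃ p : Fin M × Fin N, frontier (gridCell p.1 p.2) = gridLines M N := by
  ext ⟨x, y⟩
  constructor
  · intro h
    obtain ⟨p, hp⟩ := mem_iUnion.1 h
    refine ⟨?_, ?_⟩
    · rw [← iUnion_gridCell hM hN]
      exact mem_iUnion.2 ⟨p, (isClosed_Icc.prod isClosed_Icc).frontier_subset hp⟩
    · rw [frontier_gridCell] at hp
      rcases hp with ⟨-, h | h⟩ | ⟨h | h, -⟩
      · exact Or.inr ⟨_, h⟩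
      · exact Or.inr ⟨p.2 + 1, by simpa using h⟩
      · exact Or.inl ⟨_, h⟩
      · exact Or.inl ⟨p.1 + 1, by simpa using h⟩
  · rintro ⟨h, h'⟩
    rw [← iUnion_gridCell hM hN] at h
    obtain ⟨p, hp⟩ := mem_iUnion.1 h
    refine mem_iUnion.2 ⟨p, ?_⟩
    by_contra hn
    have hi : (x, y) ∈ interior (gridCell p.1 p.2) := by
      by_contra hi
      exact hn ⟨subset_closure hp, hi⟩
    rw [interior_gridCell] at hi
    obtain ⟨⟨a, b⟩, c, d⟩ := hi
    rcases h' with ⟨k, hk⟩ | ⟨k, hk⟩ <;> dsimp only at * <;> subst hk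
    · have a' : (p.1 : ℕ) < k := by exact_mod_cast a
      have b' : k < (p.1 : ℕ) + 1 := by exact_mod_cast b
      omega
    · have a' : (p.2 : ℕ) < k := by exact_mod_cast c
      have b' : k < (p.2 : ℕ) + 1 := by exact_mod_cast d
      omega

theorem interior_gridCell_disjoint {i j k l : ℕ} (h : ¬ (i = k ∧ j = l)) :
    Disjoint (interior (gridCell i j)) (interior (gridCell k l)) := by
  have key : ∀ {a b : ℕ} {x : ℝ}, x ∈ Ioo (a : ℝ) (a + 1) → x ∈ Ioo (b : ℝ) (b + 1) → a = b := by
    intro a b x h1 h2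
    have e1 : (a : ℝ) < b + 1 := h1.1.trans h2.2
    have e2 : (b : ℝ) < a + 1 := h2.1.trans h1.2
    have e1' : a < b + 1 := by exact_mod_cast e1
    have e2' : b < a + 1 := by exact_mod_cast e2
    omega
  rw [interior_gridCell, interior_gridCell, Set.disjoint_left]
  rintro ⟨x, y⟩ ⟨h1, h2⟩ ⟨h3, h4⟩
  exact h ⟨key h1 h3, key h2 h4⟩

theorem gridCell_inter {i j k l : ℕ} (h : ¬ (i = k ∧ j = l)) :
    gridCell i j ∩ gridCell k l = frontier (gridCell i j) ∩ frontier (gridCell k l) := by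
  have hc : ∀ a b, closure (gridCell a b) = gridCell a b := fun a b =>
    (isClosed_Icc.prod isClosed_Icc).closure_eq
  have hr : ∀ a b, gridCell a b ⊆ closure (interior (gridCell a b)) := fun a b => by
    rw [interior_gridCell, closure_prod_eq, closure_Ioo (by simp), closure_Ioo (by simp)]
    exact subset_rfl
  have key : ∀ {a b c d : ℕ}, ¬ (a = c ∧ b = d) → ∀ p ∈ gridCell a b, p ∉ interior (gridCell c d) := by
    intro a b c d hne p hp hi
    obtain ⟨q, hq, hq'⟩ := mem_closure_iff.1 (hr a b hp) _ isOpen_interior hi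
    exact Set.disjoint_left.1 (interior_gridCell_disjoint hne) hq' hq
  ext p
  constructor
  · rintro ⟨h1, h2⟩
    exact ⟨⟨subset_closure h1, key (fun h' => h ⟨h'.1.symm, h'.2.symm⟩) p h2⟩,
      subset_closure h2, key h p h1⟩
  · rintro ⟨h1, h2⟩
    exact ⟨hc i j ▸ h1.1, hc k l ▸ h2.1⟩

theorem exists_homeomorph_image_prod_Icc {a b c d a' b' c' d' : ℝ} (h1 : a < b) (h2 : c < d)
    (h1' : a' < b') (h2' : c' < d') : ∃ e : (ℝ × ℝ) ≃ₜ (ℝ × ℝ),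
      e '' (Icc a b ×ˢ Icc c d) = Icc a' b' ×ˢ Icc c' d' := by
  have key : ∀ {a b c d : ℝ}, a < b → c < d → (interior (Icc a b ×ˢ Icc c d)).Nonempty := by
    intro a b c d h1 h2
    rw [interior_prod_eq, interior_Icc, interior_Icc]
    exact (nonempty_Ioo.2 h1).prod (nonempty_Ioo.2 h2)
  obtain ⟨e, -, he, -⟩ := exists_homeomorph_image_eq ((convex_Icc a b).prod (convex_Icc c d))
    (key h1 h2) (NormedSpace.isVonNBounded_of_isBounded _
      ((Metric.isBounded_Icc a b).prod (Metric.isBounded_Icc c d)))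
    ((convex_Icc a' b').prod (convex_Icc c' d')) (key h1' h2')
    (NormedSpace.isVonNBounded_of_isBounded _
      ((Metric.isBounded_Icc a' b').prod (Metric.isBounded_Icc c' d')))
  refine ⟨e, ?_⟩
  rwa [(isClosed_Icc.prod isClosed_Icc).closure_eq, (isClosed_Icc.prod isClosed_Icc).closure_eq]
    at he

/-- The partition of the disc into the images of the `M * N` unit cells of the rectangle
`[0, M] × [0, N]` under a homeomorphism of the plane that maps the rectangle onto the disc. -/
def gridPartition {M N : ℕ} (hM : 0 < M) (hN : 0 < N) (Φ : (ℝ × ℝ) ≃ₜ ℂ)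
    (hΦ : Φ '' gridRect M N = Metric.closedBall (0 : ℂ) 1) : DiscPartition where
  card := M * N
  disc k := Φ '' gridCell (finProdFinEquiv.symm k).1 (finProdFinEquiv.symm k).2
  isDisc k := by
    obtain ⟨e, he⟩ := exists_homeomorph_image_prod_Icc
      (a := (finProdFinEquiv.symm k).1) (b := (finProdFinEquiv.symm k).1 + 1)
      (c := (finProdFinEquiv.symm k).2) (d := (finProdFinEquiv.symm k).2 + 1)
      (a' := 0) (b' := M) (c' := 0) (d' := N) (by simp) (by simp) (by simpa) (by simpa)
    refine ⟨(Φ.image _).symm.trans ((e.image _).trans ((Homeomorph.setCongr he).trans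
      ((Φ.image _).trans (Homeomorph.setCongr hΦ))))⟩
  disjoint_interior k l h := by
    rw [← Φ.image_interior, ← Φ.image_interior, Set.disjoint_image_iff Φ.injective]
    refine interior_gridCell_disjoint fun h' => h (finProdFinEquiv.symm.injective ?_)
    exact Prod.ext (Fin.ext h'.1) (Fin.ext h'.2)
  iUnion_disc := by
    rw [← image_iUnion, finProdFinEquiv.symm.surjective.iUnion_comp
      (fun p : Fin M × Fin N => gridCell p.1 p.2), iUnion_gridCell hM hN, hΦ]
  frontier_iUnion := by
    rw [← image_iUnion, finProdFinEquiv.symm.surjective.iUnion_comp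
      (fun p : Fin M × Fin N => gridCell p.1 p.2), iUnion_gridCell hM hN, hΦ,
      frontier_closedBall _ one_ne_zero]
  inter_disc k l h := by
    rw [← Φ.image_frontier, ← Φ.image_frontier, ← image_inter Φ.injective,
      ← image_inter Φ.injective, gridCell_inter]
    refine fun h' => h (finProdFinEquiv.symm.injective ?_)
    exact Prod.ext (Fin.ext h'.1) (Fin.ext h'.2)

/-- Three arcs in the line that issue from one point cannot be disjoint otherwise. -/
theorem no_triod_in_real {a : Fin 3 → ℝ → ℝ} {z : ℝ} (hc : ∀ k, Continuous (a k))
    (h0 : ∀ k, a k 0 = z)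
    (hd : ∀ k l, k ≠ l → ∀ s ∈ Icc (0 : ℝ) 1, ∀ t ∈ Icc (0 : ℝ) 1, a k s = a l t → s = 0) :
    False := by
  have hne : ∀ k, a k 1 ≠ z := fun k h => by
    obtain ⟨l, hl⟩ := exists_ne k
    exact one_ne_zero (hd k l hl.symm 1 (by simp) 0 (by simp) (h.trans (h0 l).symm))
  obtain ⟨k, l, hkl, hs⟩ := Fintype.exists_ne_map_eq_of_card_lt (fun k => decide (z < a k 1))
    (by simp)
  have up : ∀ k l, k ≠ l → z < a k 1 → a k 1 ≤ a l 1 → False := fun k l hkl h1 h2 => by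
    obtain ⟨t, ht, he⟩ := intermediate_value_Icc (zero_le_one (α := ℝ)) (hc l).continuousOn
      (show a k 1 ∈ Icc (a l 0) (a l 1) from ⟨(h0 l).symm ▸ h1.le, h2⟩)
    exact one_ne_zero (hd k l hkl 1 (by simp) t ht he.symm)
  have down : ∀ k l, k ≠ l → a k 1 < z → a l 1 ≤ a k 1 → False := fun k l hkl h1 h2 => by
    obtain ⟨t, ht, he⟩ := intermediate_value_Icc' (zero_le_one (α := ℝ)) (hc l).continuousOn
      (show a k 1 ∈ Icc (a l 1) (a l 0) from ⟨h2, (h0 l).symm ▸ h1.le⟩)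
    exact one_ne_zero (hd k l hkl 1 (by simp) t ht he.symm)
  have hs' : z < a k 1 ↔ z < a l 1 := by simpa using hs
  by_cases h : z < a k 1
  · rcases le_total (a k 1) (a l 1) with h2 | h2
    · exact up k l hkl h h2
    · exact up l k hkl.symm (hs'.1 h) h2
  · have hk := lt_of_le_of_ne (not_lt.1 h) (hne k)
    have hl := lt_of_le_of_ne (not_lt.1 fun h' => h (hs'.2 h')) (hne l)
    rcases le_total (a k 1) (a l 1) with h2 | h2
    · exact down l k hkl.symm hl h2
    · exact down k l hkl hk h2

theorem clamp_mem (s : ℝ) : clamp s ∈ Icc (0 : ℝ) 1 :=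
  ⟨le_max_left _ _, max_le zero_le_one (min_le_left _ _)⟩

theorem continuous_clamp : Continuous clamp := by unfold clamp; fun_prop

section gridPartition
variable {M N : ℕ} (hM : 0 < M) (hN : 0 < N) (Φ : (ℝ × ℝ) ≃ₜ ℂ)
  (hΦ : Φ '' gridRect M N = Metric.closedBall (0 : ℂ) 1)

theorem skeleton_gridPartition :
    (gridPartition hM hN Φ hΦ).skeleton = Φ '' gridLines M N := by
  rw [DiscPartition.skeleton, ← iUnion_frontier_gridCell hM hN, image_iUnion,
    ← finProdFinEquiv.symm.surjective.iUnion_comp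
      (fun p : Fin M × Fin N => Φ '' frontier (gridCell p.1 p.2))]
  refine iUnion_congr fun k => ?_
  rw [Φ.image_frontier]
  rfl

/-- A point of the grid from which three otherwise disjoint segments issue is a vertex. -/
theorem mem_vertices_gridPartition_of_triod {p : ℝ × ℝ} {u : Fin 3 → ℝ × ℝ}
    (hu : ∀ k, ∀ t ∈ Icc (0 : ℝ) 1, p + t • u k ∈ gridLines M N)
    (hd : ∀ k l, k ≠ l → ∀ s t : ℝ, 0 ≤ s → 0 ≤ t → s • u k = t • u l → s = 0) :
    Φ p ∈ (gridPartition hM hN Φ hΦ).vertices := by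
  refine ⟨?_, ?_⟩
  · rw [skeleton_gridPartition]
    exact ⟨p, by simpa using hu 0 0 (by simp), rfl⟩
  · rintro U hU hpU ⟨I, -, ⟨e⟩⟩
    have hev : ∀ k, ∀ᶠ r in 𝓝 (0 : ℝ), Φ (p + r • u k) ∈ U := fun k => by
      have hcont : Continuous fun r : ℝ => Φ (p + r • u k) := by fun_prop
      exact hcont.continuousAt.eventually_mem (hU.mem_nhds (by simpa using hpU))
    obtain ⟨r, hr0, hr⟩ := Metric.eventually_nhds_iff.1 (eventually_all.2 hev)
    set ρ := min (r / 2) 1 with hρ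
    have hρ0 : 0 < ρ := lt_min (by linarith) one_pos
    have hsm : ∀ t : ℝ, ρ * clamp t ∈ Icc (0 : ℝ) 1 ∧ ρ * clamp t < r := fun t => by
      obtain ⟨h0, h1⟩ := clamp_mem t
      have h2 : ρ * clamp t ≤ ρ := mul_le_of_le_one_right hρ0.le h1
      exact ⟨⟨by positivity, h2.trans (min_le_right _ _)⟩,
        h2.trans_lt ((min_le_left _ _).trans_lt (by linarith))⟩
    have hmem : ∀ k t, Φ (p + (ρ * clamp t) • u k) ∈ U ∩ (gridPartition hM hN Φ hΦ).skeleton := by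
      intro k t
      refine ⟨hr ?_ k, ?_⟩
      · rw [Real.dist_eq, sub_zero, abs_of_nonneg (hsm t).1.1]; exact (hsm t).2
      · rw [skeleton_gridPartition]
        exact mem_image_of_mem _ (hu k _ (hsm t).1)
    refine no_triod_in_real (a := fun k t => (e ⟨_, hmem k t⟩ : ℝ))
      (z := (e ⟨Φ p, hpU, by
        rw [skeleton_gridPartition]
        exact ⟨p, by simpa using hu 0 0 (by simp), rfl⟩⟩ : ℝ)) ?_ ?_ ?_
    · intro k
      refine continuous_subtype_val.comp (e.continuous.comp (Continuous.subtype_mk ?_ _))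
      have := continuous_clamp
      fun_prop
    · intro k
      have : clamp 0 = 0 := clamp_of_le le_rfl
      simp [this]
    · intro k l hkl s hs t ht h
      have h1 := congrArg Subtype.val (e.injective (Subtype.val_injective h))
      have h2 := hd k l hkl _ _ (hsm s).1.1 (hsm t).1.1 (add_left_cancel (Φ.injective h1))
      rw [clamp_of_mem hs.1 hs.2] at h2
      exact (mul_eq_zero.1 h2).resolve_left hρ0.ne'

theorem gridLines_of_horizontal {i j : ℕ} (hj : j ≤ N) {x : ℝ} (hi : i < M)
    (hx : x ∈ Icc (i : ℝ) (i + 1)) : ((x, (j : ℝ)) : ℝ × ℝ) ∈ gridLines M N := by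
  have h1 : (i : ℝ) + 1 ≤ M := by exact_mod_cast hi
  exact ⟨⟨⟨(Nat.cast_nonneg _).trans hx.1, hx.2.trans h1⟩, Nat.cast_nonneg _, Nat.cast_le.2 hj⟩,
    Or.inr ⟨j, rfl⟩⟩

theorem gridLines_of_vertical {i j : ℕ} (hi : i ≤ M) {y : ℝ} (hj : j < N)
    (hy : y ∈ Icc (j : ℝ) (j + 1)) : (((i : ℝ), y) : ℝ × ℝ) ∈ gridLines M N := by
  have h1 : (j : ℝ) + 1 ≤ N := by exact_mod_cast hj
  exact ⟨⟨⟨Nat.cast_nonneg _, Nat.cast_le.2 hi⟩, (Nat.cast_nonneg _).trans hy.1, hy.2.trans h1⟩,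
    Or.inl ⟨i, rfl⟩⟩

/-- All grid points except for the four corners of the rectangle are vertices. -/
theorem natCast_mem_vertices_gridPartition {i j : ℕ} (hi : i ≤ M) (hj : j ≤ N)
    (h : (0 < i ∧ i < M) ∨ (0 < j ∧ j < N)) :
    Φ ((i : ℝ), (j : ℝ)) ∈ (gridPartition hM hN Φ hΦ).vertices := by
  have right : i < M → ∀ t ∈ Icc (0 : ℝ) 1,
      ((i : ℝ), (j : ℝ)) + t • ((1, 0) : ℝ × ℝ) ∈ gridLines M N := fun h t ht => by
    simpa using gridLines_of_horizontal (x := i + t) hj h ⟨by linarith [ht.1], by linarith [ht.2]⟩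
  have up : j < N → ∀ t ∈ Icc (0 : ℝ) 1,
      ((i : ℝ), (j : ℝ)) + t • ((0, 1) : ℝ × ℝ) ∈ gridLines M N := fun h t ht => by
    simpa using gridLines_of_vertical (y := j + t) hi h ⟨by linarith [ht.1], by linarith [ht.2]⟩
  have left : 0 < i → ∀ t ∈ Icc (0 : ℝ) 1,
      ((i : ℝ), (j : ℝ)) + t • ((-1, 0) : ℝ × ℝ) ∈ gridLines M N := fun h t ht => by
    have e : ((i - 1 : ℕ) : ℝ) = i - 1 := by rw [Nat.cast_sub h]; simp
    simpa using gridLines_of_horizontal (x := i + -t) (i := i - 1) hj (by omega)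
      ⟨by rw [e]; linarith [ht.2], by rw [e]; linarith [ht.1]⟩
  have down : 0 < j → ∀ t ∈ Icc (0 : ℝ) 1,
      ((i : ℝ), (j : ℝ)) + t • ((0, -1) : ℝ × ℝ) ∈ gridLines M N := fun h t ht => by
    have e : ((j - 1 : ℕ) : ℝ) = j - 1 := by rw [Nat.cast_sub h]; simp
    simpa using gridLines_of_vertical (y := j + -t) (j := j - 1) hi (by omega)
      ⟨by rw [e]; linarith [ht.2], by rw [e]; linarith [ht.1]⟩
  have arms : ∀ a b c : ℝ × ℝ, (∀ t ∈ Icc (0 : ℝ) 1, ((i : ℝ), (j : ℝ)) + t • a ∈ gridLines M N) →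
      (∀ t ∈ Icc (0 : ℝ) 1, ((i : ℝ), (j : ℝ)) + t • b ∈ gridLines M N) →
      (∀ t ∈ Icc (0 : ℝ) 1, ((i : ℝ), (j : ℝ)) + t • c ∈ gridLines M N) →
      ∀ k, ∀ t ∈ Icc (0 : ℝ) 1, ((i : ℝ), (j : ℝ)) + t • (![a, b, c] : Fin 3 → ℝ × ℝ) k ∈
        gridLines M N := by
    intro a b c ha hb hc k
    fin_cases k
    exacts [ha, hb, hc]
  have indep : ∀ a b c : ℝ × ℝ, (∀ s t : ℝ, 0 ≤ s → 0 ≤ t → s • a = t • b → s = 0 ∧ t = 0) →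
      (∀ s t : ℝ, 0 ≤ s → 0 ≤ t → s • a = t • c → s = 0 ∧ t = 0) → (∀ s t : ℝ, 0 ≤ s → 0 ≤ t → s • b = t • c → s = 0 ∧ t = 0) →
      ∀ k l, k ≠ l → ∀ s t : ℝ, 0 ≤ s → 0 ≤ t → s • (![a, b, c] : Fin 3 → ℝ × ℝ) k =
        t • (![a, b, c] : Fin 3 → ℝ × ℝ) l → s = 0 := by
    intro a b c hab hac hbc k l hkl s t hs ht h
    fin_cases k <;> fin_cases l
    exacts [absurd rfl hkl, (hab s t hs ht h).1, (hac s t hs ht h).1, (hab t s ht hs h.symm).2, absurd rfl hkl,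
      (hbc s t hs ht h).1, (hac t s ht hs h.symm).2, (hbc t s ht hs h.symm).2, absurd rfl hkl]
  rcases h with ⟨h1, h2⟩ | ⟨h1, h2⟩
  · rcases Nat.eq_zero_or_pos j with h0 | h0
    · refine mem_vertices_gridPartition_of_triod hM hN Φ hΦ
        (arms _ _ _ (right h2) (left h1) (up (h0 ▸ hN))) (indep _ _ _ ?_ ?_ ?_)
      all_goals
        intro s t hs ht hst
        simp only [Prod.smul_mk, smul_eq_mul, mul_one, mul_zero, Prod.mk.injEq] at hst
        constructor <;> linarith [hst.1, hst.2]
    · refine mem_vertices_gridPartition_of_triod hM hN Φ hΦ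
        (arms _ _ _ (right h2) (left h1) (down h0)) (indep _ _ _ ?_ ?_ ?_)
      all_goals
        intro s t hs ht hst
        simp only [Prod.smul_mk, smul_eq_mul, mul_one, mul_zero, Prod.mk.injEq] at hst
        constructor <;> linarith [hst.1, hst.2]
  · rcases Nat.eq_zero_or_pos i with h0 | h0
    · refine mem_vertices_gridPartition_of_triod hM hN Φ hΦ
        (arms _ _ _ (up h2) (down h1) (right (h0 ▸ hM))) (indep _ _ _ ?_ ?_ ?_)
      all_goals
        intro s t hs ht hst
        simp only [Prod.smul_mk, smul_eq_mul, mul_one, mul_zero, Prod.mk.injEq] at hst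
        constructor <;> linarith [hst.1, hst.2]
    · refine mem_vertices_gridPartition_of_triod hM hN Φ hΦ
        (arms _ _ _ (up h2) (down h1) (left h0)) (indep _ _ _ ?_ ?_ ?_)
      all_goals
        intro s t hs ht hst
        simp only [Prod.smul_mk, smul_eq_mul, mul_one, mul_zero, Prod.mk.injEq] at hst
        constructor <;> linarith [hst.1, hst.2]

theorem image_interior_gridRect (Φ : (ℝ × ℝ) ≃ₜ ℂ)
    (hΦ : Φ '' gridRect M N = Metric.closedBall (0 : ℂ) 1) :
    Φ '' (Ioo (0 : ℝ) M ×ˢ Ioo (0 : ℝ) N) = Metric.ball 0 1 := by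
  rw [← interior_gridRect, Φ.image_interior, hΦ, interior_closedBall _ one_ne_zero]

/-- A preconnected subset of `A` that meets the relatively clopen subset `A ∩ O = A ∩ C` of `A` is
contained in it. -/
theorem subset_of_isPreconnected_of_relatively_clopen {Z : Type*} [TopologicalSpace Z]
    {s A O C : Set Z} (hs : IsPreconnected s) (hsA : s ⊆ A) (hO : IsOpen O) (hC : IsClosed C)
    (hne : (s ∩ O).Nonempty) (h1 : A ∩ O ⊆ C) (h2 : A ∩ C ⊆ O) : s ⊆ C := by
  have h := isPreconnected_iff_subset_of_disjoint.1 hs O Cᶜ hO hC.isOpen_compl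
    (fun x hx => by
      by_cases hxC : x ∈ C
      · exact Or.inl (h2 ⟨hsA hx, hxC⟩)
      · exact Or.inr hxC)
    (by
      ext x
      simp only [mem_inter_iff, mem_compl_iff, mem_empty_iff_false, iff_false]
      exact fun ⟨hx, hO, hn⟩ => hn (h1 ⟨hsA hx, hO⟩))
  rcases h with h | h
  · exact fun x hx => h1 ⟨hsA hx, h hx⟩
  · obtain ⟨x, hx, hxO⟩ := hne
    exact absurd (h1 ⟨hsA hx, hxO⟩) (h hx)

theorem exists_nat_mem_Ioo_of_ne {x : ℝ} (hx0 : 0 < x) {M : ℕ} (hxM : x < M)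
    (h : ∀ i : ℕ, x ≠ i) : ∃ i < M, x ∈ Ioo (i : ℝ) (i + 1) :=
  ⟨⌊x⌋₊, (Nat.floor_lt hx0.le).2 hxM, lt_of_le_of_ne (Nat.floor_le hx0.le) (h _).symm,
    Nat.lt_floor_add_one x⟩

theorem not_exists_natCast_mem_Ioo {i k : ℕ} (h : (k : ℝ) ∈ Ioo (i : ℝ) (i + 1)) : False := by
  have h1 : i < k := by exact_mod_cast h.1
  have h2 : k < i + 1 := by exact_mod_cast h.2
  omega

/-- An edge of a grid partition that leaves the unit circle runs inside one side of a cell, and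
that side is not contained in the boundary of the rectangle. -/
theorem isEdge_gridPartition {c : ℝ → ℂ} (hc : (gridPartition hM hN Φ hΦ).IsEdge c)
    (hs : ¬ MapsTo c (Icc 0 1) (Metric.sphere (0 : ℂ) 1)) :
    (∃ i j : ℕ, i < M ∧ 0 < j ∧ j < N ∧
      MapsTo (fun t => Φ.symm (c t)) (Icc 0 1) (Icc (i : ℝ) (i + 1) ×ˢ {(j : ℝ)})) ∨
    (∃ i j : ℕ, 0 < i ∧ i < M ∧ j < N ∧
      MapsTo (fun t => Φ.symm (c t)) (Icc 0 1) ({(i : ℝ)} ×ˢ Icc (j : ℝ) (j + 1))) := by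
  set γ : ℝ → ℝ × ℝ := fun t => Φ.symm (c t) with hγ
  have hγc : ContinuousOn γ (Icc 0 1) := Φ.symm.continuous.comp_continuousOn hc.continuousOn
  have hγG : ∀ t ∈ Icc (0 : ℝ) 1, γ t ∈ gridLines M N := fun t ht => by
    have := hc.mapsTo ht
    rw [skeleton_gridPartition] at this
    obtain ⟨q, hq, he⟩ := this
    simpa [hγ, ← he] using hq
  have hR : IsOpen (Ioo (0 : ℝ) M ×ˢ Ioo (0 : ℝ) N) := isOpen_Ioo.prod isOpen_Ioo
  have hcl : closure (Ioo (0 : ℝ) 1) = Icc 0 1 := closure_Ioo zero_ne_one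
  -- Otherwise the edge would by continuity stay in the boundary of the rectangle.
  obtain ⟨t₁, ht₁, hin⟩ : ∃ t ∈ Ioo (0 : ℝ) 1, γ t ∈ Ioo (0 : ℝ) M ×ˢ Ioo (0 : ℝ) N := by
    by_contra hno
    push Not at hno
    refine hs fun t ht => ?_
    have h1 : γ t ∈ (Ioo (0 : ℝ) M ×ˢ Ioo (0 : ℝ) N)ᶜ := by
      rw [← hcl] at ht hγc
      exact MapsTo.closure_of_continuousOn (s := Ioo 0 1) (fun t ht => hno t ht) hγc |>.mono_right
        hR.isClosed_compl.closure_subset ht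
    have h2 : c t ∈ Metric.closedBall (0 : ℂ) 1 := by
      rw [← hΦ]
      exact ⟨γ t, (hγG t ht).1, by simp [hγ]⟩
    have h3 : c t ∉ Metric.ball (0 : ℂ) 1 := by
      rw [← image_interior_gridRect Φ hΦ]
      rintro ⟨q, hq, he⟩
      exact h1 (by simpa [hγ, ← he] using hq)
    rw [mem_sphere_zero_iff_norm]
    rw [mem_closedBall_zero_iff] at h2
    rw [mem_ball_zero_iff, not_lt] at h3
    exact le_antisymm h2 h3
  -- The grid without its vertices, the corners of the rectangle excepted.
  set A : Set (ℝ × ℝ) := {q | q ∈ gridLines M N ∧ Φ q ∉ (gridPartition hM hN Φ hΦ).vertices}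
  have hγA : γ '' Ioo 0 1 ⊆ A := by
    rintro _ ⟨t, ht, rfl⟩
    exact ⟨hγG t (Ioo_subset_Icc_self ht), by simpa [hγ] using hc.notMem t ht⟩
  have hpre : IsPreconnected (γ '' Ioo 0 1) :=
    isPreconnected_Ioo.image _ (hγc.mono Ioo_subset_Icc_self)
  have hext : ∀ C : Set (ℝ × ℝ), IsClosed C → γ '' Ioo 0 1 ⊆ C → MapsTo γ (Icc 0 1) C := by
    intro C hC h t ht
    rw [← hcl] at ht hγc
    exact MapsTo.closure_of_continuousOn (s := Ioo 0 1) (mapsTo_iff_image_subset.2 h) hγc |>.mono_right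
      hC.closure_subset ht
  have hA₁ := hγA ⟨t₁, ht₁, rfl⟩
  obtain ⟨x, y, hq⟩ : ∃ x y, γ t₁ = (x, y) := ⟨_, _, rfl⟩
  rw [hq] at hin hA₁
  obtain ⟨⟨hx0, hxM⟩, hy0, hyN⟩ := hin
  dsimp only at hx0 hxM hy0 hyN
  have hnot : ¬ ((∃ i : ℕ, x = i) ∧ ∃ j : ℕ, y = j) := by
    rintro ⟨⟨i, rfl⟩, j, rfl⟩
    refine hA₁.2 (natCast_mem_vertices_gridPartition hM hN Φ hΦ ?_ ?_ (Or.inl ⟨?_, ?_⟩))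
    · exact_mod_cast hxM.le
    · exact_mod_cast hyN.le
    · exact_mod_cast hx0
    · exact_mod_cast hxM
  rcases hA₁.1.2 with ⟨i, hi⟩ | ⟨j, hj⟩
  · right
    dsimp only at hi
    subst hi
    obtain ⟨j, hjN, hj⟩ := exists_nat_mem_Ioo_of_ne hy0 hyN fun j h => hnot ⟨⟨i, rfl⟩, j, h⟩
    have hi0 : 0 < i := by exact_mod_cast hx0
    have hiM : i < M := by exact_mod_cast hxM
    refine ⟨i, j, hi0, hiM, hjN, hext _ (isClosed_singleton.prod isClosed_Icc) ?_⟩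
    refine subset_of_isPreconnected_of_relatively_clopen hpre hγA
      (O := Ioo (i - 1 : ℝ) (i + 1) ×ˢ Ioo (j : ℝ) (j + 1)) (isOpen_Ioo.prod isOpen_Ioo)
      (isClosed_singleton.prod isClosed_Icc)
      ⟨γ t₁, ⟨t₁, ht₁, rfl⟩, by rw [hq]; exact ⟨⟨by simp, by simp⟩, hj⟩⟩ ?_ ?_
    · rintro ⟨a, b⟩ ⟨⟨hG, -⟩, ⟨ha1, ha2⟩, hb⟩
      refine ⟨?_, Ioo_subset_Icc_self hb⟩
      rcases hG.2 with ⟨k, hk⟩ | ⟨k, hk⟩ <;> dsimp only at hk ha1 ha2 hb <;> subst hk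
      · have h1 : i < k + 1 := by
          have : (i : ℝ) < k + 1 := by linarith
          exact_mod_cast this
        have h2 : k < i + 1 := by exact_mod_cast ha2
        have : k = i := by omega
        simp [this]
      · exact (not_exists_natCast_mem_Ioo hb).elim
    · rintro ⟨a, b⟩ ⟨⟨hG, hv⟩, ha, hb⟩
      dsimp only at ha hb
      rw [mem_singleton_iff] at ha
      subst ha
      refine ⟨⟨by simp, by simp⟩, lt_of_le_of_ne hb.1 ?_, lt_of_le_of_ne hb.2 ?_⟩ <;>
        dsimp only <;> rintro h
      · rw [← h] at hv
        exact hv (natCast_mem_vertices_gridPartition hM hN Φ hΦ hiM.le hjN.le (Or.inl ⟨hi0, hiM⟩))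
      · rw [h] at hv
        have := natCast_mem_vertices_gridPartition hM hN Φ hΦ hiM.le
          (Nat.succ_le_of_lt hjN) (Or.inl ⟨hi0, hiM⟩)
        exact hv (by simpa using this)
  · left
    dsimp only at hj
    subst hj
    obtain ⟨i, hiM, hi⟩ := exists_nat_mem_Ioo_of_ne hx0 hxM fun i h => hnot ⟨⟨i, h⟩, j, rfl⟩
    have hj0 : 0 < j := by exact_mod_cast hy0
    have hjN : j < N := by exact_mod_cast hyN
    refine ⟨i, j, hiM, hj0, hjN, hext _ (isClosed_Icc.prod isClosed_singleton) ?_⟩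
    refine subset_of_isPreconnected_of_relatively_clopen hpre hγA
      (O := Ioo (i : ℝ) (i + 1) ×ˢ Ioo (j - 1 : ℝ) (j + 1)) (isOpen_Ioo.prod isOpen_Ioo)
      (isClosed_Icc.prod isClosed_singleton)
      ⟨γ t₁, ⟨t₁, ht₁, rfl⟩, by rw [hq]; exact ⟨hi, ⟨by simp, by simp⟩⟩⟩ ?_ ?_
    · rintro ⟨a, b⟩ ⟨⟨hG, -⟩, ha, ⟨hb1, hb2⟩⟩
      refine ⟨Ioo_subset_Icc_self ha, ?_⟩
      rcases hG.2 with ⟨k, hk⟩ | ⟨k, hk⟩ <;> dsimp only at hk hb1 hb2 ha <;> subst hk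
      · exact (not_exists_natCast_mem_Ioo ha).elim
      · have h1 : j < k + 1 := by
          have : (j : ℝ) < k + 1 := by linarith
          exact_mod_cast this
        have h2 : k < j + 1 := by exact_mod_cast hb2
        have : k = j := by omega
        simp [this]
    · rintro ⟨a, b⟩ ⟨⟨hG, hv⟩, ha, hb⟩
      dsimp only at ha hb
      rw [mem_singleton_iff] at hb
      subst hb
      refine ⟨⟨lt_of_le_of_ne ha.1 ?_, lt_of_le_of_ne ha.2 ?_⟩, by simp, by simp⟩ <;>
        dsimp only <;> rintro h
      · rw [← h] at hv
        exact hv (natCast_mem_vertices_gridPartition hM hN Φ hΦ hiM.le hjN.le (Or.inr ⟨hj0, hjN⟩))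
      · rw [h] at hv
        have := natCast_mem_vertices_gridPartition hM hN Φ hΦ
          (Nat.succ_le_of_lt hiM) hjN.le (Or.inr ⟨hj0, hjN⟩)
        exact hv (by simpa using this)

end gridPartition

/-! ### Filling a loop along a grid -/

section geodesic
variable {X : Type*} [MetricSpace X]

/-- A path that runs monotonically along a part of a geodesic is a geodesic, traversed
monotonically. -/
theorem IsGeodesicSegment.exists_subarc {g : ℝ → X} {x y : X} (hg : IsGeodesicSegment g x y)
    {P : ℝ → X} {u : ℝ → ℝ} (huc : ContinuousOn u (Icc 0 1))
    (hum : MonotoneOn u (Icc 0 1) ∨ AntitoneOn u (Icc 0 1))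
    (hu : MapsTo u (Icc 0 1) (Icc 0 (dist x y))) (hP : ∀ t ∈ Icc (0 : ℝ) 1, P t = g (u t)) :
    ∃ (g' : ℝ → X) (σ : ℝ → ℝ), IsGeodesicSegment g' (P 0) (P 1) ∧
      ContinuousOn σ (Icc 0 1) ∧ MonotoneOn σ (Icc 0 1) ∧
      σ 0 = 0 ∧ σ 1 = dist (P 0) (P 1) ∧ ∀ t ∈ Icc (0 : ℝ) 1, P t = g' (σ t) := by
  have m0 : (0 : ℝ) ∈ Icc (0 : ℝ) 1 := by simp
  have m1 : (1 : ℝ) ∈ Icc (0 : ℝ) 1 := by simp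
  have hd : dist (P 0) (P 1) = |u 0 - u 1| := by
    rw [hP 0 m0, hP 1 m1, hg.2.2 _ (hu m0) _ (hu m1)]
  have h0 := hu m0
  have h1 := hu m1
  rcases hum with hum | hum
  · have h01 := hum m0 m1 zero_le_one
    rw [abs_sub_comm, abs_of_nonneg (by linarith)] at hd
    refine ⟨fun s => g (u 0 + s), fun t => u t - u 0, ⟨?_, ?_, ?_⟩, by fun_prop,
      fun s hs t ht h => sub_le_sub_right (hum hs ht h) _, by simp, hd.symm, ?_⟩
    · simp [hP 0 m0]
    · change g (u 0 + dist (P 0) (P 1)) = _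
      rw [hd, hP 1 m1]; congr 1; ring
    · intro s hs t ht
      rw [hd] at hs ht
      dsimp only
      rw [hg.2.2 _ ⟨by linarith [hs.1, h0.1], by linarith [hs.2, h1.2]⟩ _
        ⟨by linarith [ht.1, h0.1], by linarith [ht.2, h1.2]⟩]
      congr 1; ring
    · intro t ht
      simp [hP t ht]
  · have h01 := hum m0 m1 zero_le_one
    rw [abs_of_nonneg (by linarith)] at hd
    refine ⟨fun s => g (u 0 - s), fun t => u 0 - u t, ⟨?_, ?_, ?_⟩, by fun_prop,
      fun s hs t ht h => sub_le_sub_left (hum hs ht h) _, by simp, hd.symm, ?_⟩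
    · simp [hP 0 m0]
    · change g (u 0 - dist (P 0) (P 1)) = _
      rw [hd, hP 1 m1]; congr 1; ring
    · intro s hs t ht
      rw [hd] at hs ht
      dsimp only
      rw [hg.2.2 _ ⟨by linarith [hs.2, h1.1], by linarith [hs.1, h0.2]⟩ _
        ⟨by linarith [ht.2, h1.1], by linarith [ht.1, h0.2]⟩, abs_sub_comm]
      congr 1; ring
    · intro t ht
      simp [hP t ht]

theorem eVariationOn_le_of_dist_le {f : ℝ → X} {a b r : ℝ} (hr : 0 ≤ r)
    (h : ∀ s ∈ Icc a b, ∀ t ∈ Icc a b, dist (f s) (f t) ≤ r * |s - t|) :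
    eVariationOn f (Icc a b) ≤ ENNReal.ofReal (r * (b - a)) := by
  have hl : LipschitzOnWith r.toNNReal f (Icc a b) :=
    LipschitzOnWith.of_dist_le_mul fun s hs t ht => by
      rw [Real.coe_toNNReal _ hr, Real.dist_eq]; exact h s hs t ht
  have := hl.comp_eVariationOn_le (g := id) (s := Icc a b) fun t ht => ht
  rw [eVariationOn_id_Icc] at this
  rwa [ENNReal.ofReal_mul hr]

/-- The map on the grid lines of `[0, M] × [0, N]` that is `b` on the boundary and the geodesic from
`v i j` to a neighbouring value, at constant speed, on each side of a cell in the interior. -/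
def gridMap (M N : ℕ) (b : ℝ × ℝ → X) (v : ℕ → ℕ → X) (geo : X → X → ℝ → X) (p : ℝ × ℝ) : X :=
  open Classical in
  if p ∉ Ioo (0 : ℝ) M ×ˢ Ioo (0 : ℝ) N then b p
  else if p.2 = ⌊p.2⌋₊ then
    geo (v ⌊p.1⌋₊ ⌊p.2⌋₊) (v (⌊p.1⌋₊ + 1) ⌊p.2⌋₊)
      ((p.1 - ⌊p.1⌋₊) * dist (v ⌊p.1⌋₊ ⌊p.2⌋₊) (v (⌊p.1⌋₊ + 1) ⌊p.2⌋₊))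
  else
    geo (v ⌊p.1⌋₊ ⌊p.2⌋₊) (v ⌊p.1⌋₊ (⌊p.2⌋₊ + 1))
      ((p.2 - ⌊p.2⌋₊) * dist (v ⌊p.1⌋₊ ⌊p.2⌋₊) (v ⌊p.1⌋₊ (⌊p.2⌋₊ + 1)))

variable {M N : ℕ} {b : ℝ × ℝ → X} {v : ℕ → ℕ → X} {geo : X → X → ℝ → X}

theorem gridMap_of_notMem {p : ℝ × ℝ} (hp : p ∉ Ioo (0 : ℝ) M ×ˢ Ioo (0 : ℝ) N) :
    gridMap M N b v geo p = b p := if_pos hp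

theorem gridMap_natCast (hgeo : ∀ x y, IsGeodesicSegment (geo x y) x y)
    (hv : ∀ i ≤ M, ∀ j ≤ N, (i = 0 ∨ i = M ∨ j = 0 ∨ j = N) → v i j = b (i, j))
    {i j : ℕ} (hi : i ≤ M) (hj : j ≤ N) : gridMap M N b v geo (i, j) = v i j := by
  by_cases h : ((i : ℝ), (j : ℝ)) ∈ Ioo (0 : ℝ) M ×ˢ Ioo (0 : ℝ) N
  · rw [gridMap, if_neg (not_not.2 h)]
    simp [(hgeo _ _).1]
  · rw [gridMap_of_notMem h, hv i hi j hj]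
    by_contra hn
    refine h ⟨⟨?_, ?_⟩, ?_, ?_⟩ <;> simp only [Nat.cast_pos, Nat.cast_lt] <;> omega

theorem gridMap_horizontal (hgeo : ∀ x y, IsGeodesicSegment (geo x y) x y)
    (hv : ∀ i ≤ M, ∀ j ≤ N, (i = 0 ∨ i = M ∨ j = 0 ∨ j = N) → v i j = b (i, j))
    {i j : ℕ} (hi : i < M) (hj0 : 0 < j) (hj : j < N) {x : ℝ} (hx : x ∈ Icc (i : ℝ) (i + 1)) :
    gridMap M N b v geo (x, j) =
      geo (v i j) (v (i + 1) j) ((x - i) * dist (v i j) (v (i + 1) j)) := by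
  rcases hx.1.lt_or_eq with h1 | h1
  · rcases hx.2.lt_or_eq with h2 | h2
    · have hM : (i : ℝ) + 1 ≤ M := by exact_mod_cast hi
      have hf : ⌊x⌋₊ = i := (Nat.floor_eq_iff ((Nat.cast_nonneg _).trans hx.1)).2 ⟨h1.le, h2⟩
      have hmem : (x, (j : ℝ)) ∈ Ioo (0 : ℝ) M ×ˢ Ioo (0 : ℝ) N :=
        ⟨⟨(Nat.cast_nonneg _).trans_lt h1, h2.trans_le hM⟩, by simpa using hj0, by simpa using hj⟩
      rw [gridMap, if_neg (not_not.2 hmem)]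
      simp [hf]
    · have := gridMap_natCast hgeo hv (Nat.succ_le_of_lt hi) hj.le
      push_cast at this
      rw [h2, this]
      simp [(hgeo _ _).2.1]
  · rw [← h1, gridMap_natCast hgeo hv hi.le hj.le]
    simp [(hgeo _ _).1]

theorem gridMap_vertical (hgeo : ∀ x y, IsGeodesicSegment (geo x y) x y)
    (hv : ∀ i ≤ M, ∀ j ≤ N, (i = 0 ∨ i = M ∨ j = 0 ∨ j = N) → v i j = b (i, j))
    {i j : ℕ} (hi0 : 0 < i) (hi : i < M) (hj : j < N) {y : ℝ} (hy : y ∈ Icc (j : ℝ) (j + 1)) :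
    gridMap M N b v geo (i, y) =
      geo (v i j) (v i (j + 1)) ((y - j) * dist (v i j) (v i (j + 1))) := by
  rcases hy.1.lt_or_eq with h1 | h1
  · rcases hy.2.lt_or_eq with h2 | h2
    · have hN : (j : ℝ) + 1 ≤ N := by exact_mod_cast hj
      have hf : ⌊y⌋₊ = j := (Nat.floor_eq_iff ((Nat.cast_nonneg _).trans hy.1)).2 ⟨h1.le, h2⟩
      have hmem : ((i : ℝ), y) ∈ Ioo (0 : ℝ) M ×ˢ Ioo (0 : ℝ) N :=
        ⟨⟨by simpa using hi0, by simpa using hi⟩, (Nat.cast_nonneg _).trans_lt h1, h2.trans_le hN⟩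
      rw [gridMap, if_neg (not_not.2 hmem)]
      simp [hf, h1.ne']
    · have := gridMap_natCast hgeo hv hi.le (Nat.succ_le_of_lt hj)
      push_cast at this
      rw [h2, this]
      simp [(hgeo _ _).2.1]
  · rw [← h1, gridMap_natCast hgeo hv hi.le hj.le]
    simp [(hgeo _ _).1]

theorem IsGeodesicSegment.dist_mul_le {g : ℝ → X} {x y : X} (hg : IsGeodesicSegment g x y) {r a : ℝ}
    (h : dist x y ≤ r) {s t : ℝ} (hs : s ∈ Icc a (a + 1)) (ht : t ∈ Icc a (a + 1)) :
    dist (g ((s - a) * dist x y)) (g ((t - a) * dist x y)) ≤ r * |s - t| := by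
  have key : ∀ s ∈ Icc a (a + 1), (s - a) * dist x y ∈ Icc 0 (dist x y) := fun s hs =>
    ⟨mul_nonneg (by linarith [hs.1]) dist_nonneg,
      mul_le_of_le_one_left dist_nonneg (by linarith [hs.2])⟩
  rw [hg.2.2 _ (key s hs) _ (key t ht), ← sub_mul, sub_sub_sub_cancel_right, abs_mul,
    abs_of_nonneg dist_nonneg, mul_comm]
  gcongr

theorem dist_gridMap_horizontal_le (hgeo : ∀ x y, IsGeodesicSegment (geo x y) x y)
    (hv : ∀ i ≤ M, ∀ j ≤ N, (i = 0 ∨ i = M ∨ j = 0 ∨ j = N) → v i j = b (i, j)) {r : ℝ}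
    (hh : ∀ i < M, ∀ j ≤ N, dist (v i j) (v (i + 1) j) ≤ r)
    (hb : ∀ i < M, ∀ j : ℕ, j = 0 ∨ j = N → ∀ s ∈ Icc (i : ℝ) (i + 1), ∀ t ∈ Icc (i : ℝ) (i + 1),
      dist (b (s, j)) (b (t, j)) ≤ r * |s - t|)
    {i j : ℕ} (hi : i < M) (hj : j ≤ N) {s t : ℝ} (hs : s ∈ Icc (i : ℝ) (i + 1))
    (ht : t ∈ Icc (i : ℝ) (i + 1)) :
    dist (gridMap M N b v geo (s, j)) (gridMap M N b v geo (t, j)) ≤ r * |s - t| := by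
  by_cases h : j = 0 ∨ j = N
  · rw [gridMap_of_notMem, gridMap_of_notMem]
    · exact hb i hi j h s hs t ht
    all_goals
      rintro ⟨-, h1, h2⟩
      rcases h with rfl | rfl
      · simp at h1
      · exact lt_irrefl _ h2
  · rw [gridMap_horizontal hgeo hv hi (by omega) (by omega) hs,
      gridMap_horizontal hgeo hv hi (by omega) (by omega) ht]
    exact (hgeo _ _).dist_mul_le (hh i hi j hj) hs ht

theorem dist_gridMap_vertical_le (hgeo : ∀ x y, IsGeodesicSegment (geo x y) x y)
    (hv : ∀ i ≤ M, ∀ j ≤ N, (i = 0 ∨ i = M ∨ j = 0 ∨ j = N) → v i j = b (i, j)) {r : ℝ}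
    (hh : ∀ i ≤ M, ∀ j < N, dist (v i j) (v i (j + 1)) ≤ r)
    (hb : ∀ j < N, ∀ i : ℕ, i = 0 ∨ i = M → ∀ s ∈ Icc (j : ℝ) (j + 1), ∀ t ∈ Icc (j : ℝ) (j + 1),
      dist (b (i, s)) (b (i, t)) ≤ r * |s - t|)
    {i j : ℕ} (hi : i ≤ M) (hj : j < N) {s t : ℝ} (hs : s ∈ Icc (j : ℝ) (j + 1))
    (ht : t ∈ Icc (j : ℝ) (j + 1)) :
    dist (gridMap M N b v geo (i, s)) (gridMap M N b v geo (i, t)) ≤ r * |s - t| := by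
  by_cases h : i = 0 ∨ i = M
  · rw [gridMap_of_notMem, gridMap_of_notMem]
    · exact hb j hj i h s hs t ht
    all_goals
      rintro ⟨⟨h1, h2⟩, -⟩
      rcases h with rfl | rfl
      · simp at h1
      · exact lt_irrefl _ h2
  · rw [gridMap_vertical hgeo hv (by omega) (by omega) hj hs,
      gridMap_vertical hgeo hv (by omega) (by omega) hj ht]
    exact (hgeo _ _).dist_mul_le (hh i hi j hj) hs ht

/-- The length of the boundary of a cell under a map that is `r`-Lipschitz on each of the four
sides. -/
theorem eVariationOn_perimeter_le {G : ℝ × ℝ → X} {a b r : ℝ} (hr : 0 ≤ r)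
    (hh : ∀ y ∈ ({b, b + 1} : Set ℝ), ∀ s ∈ Icc a (a + 1), ∀ t ∈ Icc a (a + 1),
      dist (G (s, y)) (G (t, y)) ≤ r * |s - t|)
    (hv : ∀ x ∈ ({a, a + 1} : Set ℝ), ∀ s ∈ Icc b (b + 1), ∀ t ∈ Icc b (b + 1),
      dist (G (x, s)) (G (x, t)) ≤ r * |s - t|) :
    eVariationOn (fun t => G ((a, b) + perimeter t)) (Icc 0 4) ≤ ENNReal.ofReal (4 * r) := by
  set f : ℝ → X := fun t => G ((a, b) + perimeter t) with hf
  have h1 : eVariationOn f (Icc 0 1) ≤ ENNReal.ofReal (r * (1 - 0)) := by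
    refine eVariationOn_le_of_dist_le hr fun s hs t ht => ?_
    simp only [hf]
    rw [perimeter_bottom hs.1 hs.2, perimeter_bottom ht.1 ht.2, Prod.mk_add_mk, Prod.mk_add_mk,
      add_zero]
    refine (hh b (by simp) _ ⟨?_, ?_⟩ _ ⟨?_, ?_⟩).trans_eq (by congr 2; ring) <;>
      linarith [hs.1, hs.2, ht.1, ht.2]
  have h2 : eVariationOn f (Icc 1 2) ≤ ENNReal.ofReal (r * (2 - 1)) := by
    refine eVariationOn_le_of_dist_le hr fun s hs t ht => ?_
    simp only [hf]
    rw [perimeter_right hs.1 hs.2, perimeter_right ht.1 ht.2, Prod.mk_add_mk, Prod.mk_add_mk]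
    refine (hv (a + 1) (by simp) _ ⟨?_, ?_⟩ _ ⟨?_, ?_⟩).trans_eq (by congr 2; ring) <;>
      linarith [hs.1, hs.2, ht.1, ht.2]
  have h3 : eVariationOn f (Icc 2 3) ≤ ENNReal.ofReal (r * (3 - 2)) := by
    refine eVariationOn_le_of_dist_le hr fun s hs t ht => ?_
    simp only [hf]
    rw [perimeter_top hs.1 hs.2, perimeter_top ht.1 ht.2, Prod.mk_add_mk, Prod.mk_add_mk]
    refine (hh (b + 1) (by simp) _ ⟨?_, ?_⟩ _ ⟨?_, ?_⟩).trans_eq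
      (by rw [abs_sub_comm s t]; congr 2; ring) <;>
      linarith [hs.1, hs.2, ht.1, ht.2]
  have h4 : eVariationOn f (Icc 3 4) ≤ ENNReal.ofReal (r * (4 - 3)) := by
    refine eVariationOn_le_of_dist_le hr fun s hs t ht => ?_
    simp only [hf]
    rw [perimeter_left hs.1 hs.2, perimeter_left ht.1 ht.2, Prod.mk_add_mk, Prod.mk_add_mk,
      add_zero]
    refine (hv a (by simp) _ ⟨?_, ?_⟩ _ ⟨?_, ?_⟩).trans_eq
      (by rw [abs_sub_comm s t]; congr 2; ring) <;>
      linarith [hs.1, hs.2, ht.1, ht.2]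
  have e1 := eVariationOn.Icc_add_Icc f (s := univ) (a := (0 : ℝ)) (b := 1) (c := 2) (by norm_num)
    (by norm_num) (mem_univ _)
  have e2 := eVariationOn.Icc_add_Icc f (s := univ) (a := (0 : ℝ)) (b := 2) (c := 3) (by norm_num)
    (by norm_num) (mem_univ _)
  have e3 := eVariationOn.Icc_add_Icc f (s := univ) (a := (0 : ℝ)) (b := 3) (c := 4) (by norm_num)
    (by norm_num) (mem_univ _)
  simp only [univ_inter] at e1 e2 e3
  rw [← e3, ← e2, ← e1]
  refine (add_le_add (add_le_add (add_le_add h1 h2) h3) h4).trans_eq ?_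
  rw [← ENNReal.ofReal_add (by linarith) (by linarith),
    ← ENNReal.ofReal_add (by linarith) (by linarith),
    ← ENNReal.ofReal_add (by linarith) (by linarith)]
  congr 1; ring

/-- A grid of points of mesh `r` that extends a loop gives a partition of that loop into `M * N`
pieces of length at most `4 * r`. -/
theorem partitionNumber_le_of_grid (hgeod : IsGeodesicSpace X) (α : C(Circle, X))
    (hM : 0 < M) (hN : 0 < N) (Φ : (ℝ × ℝ) ≃ₜ ℂ)
    (hΦ : Φ '' gridRect M N = Metric.closedBall (0 : ℂ) 1) {r : ℝ} (hr : 0 ≤ r)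
    (hα : ∀ z : Circle, b (Φ.symm z) = α z)
    (hv : ∀ i ≤ M, ∀ j ≤ N, (i = 0 ∨ i = M ∨ j = 0 ∨ j = N) → v i j = b (i, j))
    (hh : ∀ i < M, ∀ j ≤ N, dist (v i j) (v (i + 1) j) ≤ r)
    (hh' : ∀ i ≤ M, ∀ j < N, dist (v i j) (v i (j + 1)) ≤ r)
    (hb : ∀ i < M, ∀ j : ℕ, j = 0 ∨ j = N → ∀ s ∈ Icc (i : ℝ) (i + 1), ∀ t ∈ Icc (i : ℝ) (i + 1),
      dist (b (s, j)) (b (t, j)) ≤ r * |s - t|)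
    (hb' : ∀ j < N, ∀ i : ℕ, i = 0 ∨ i = M → ∀ s ∈ Icc (j : ℝ) (j + 1),
      ∀ t ∈ Icc (j : ℝ) (j + 1), dist (b (i, s)) (b (i, t)) ≤ r * |s - t|)
    {δ : ℝ≥0∞} (hδ : ENNReal.ofReal (4 * r) < δ) :
    partitionNumber α δ ≤ (M * N : ℕ) := by
  choose geo hgeo using hgeod
  set G := gridMap M N b v geo with hG
  set F : ℂ → X := fun z => G (Φ.symm z) with hF
  have hFα : ∀ z : Circle, F z = α z := fun z => by
    rw [← hα z]
    refine gridMap_of_notMem fun hz => ?_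
    have h1 : (z : ℂ) ∈ Metric.ball (0 : ℂ) 1 := by
      rw [← image_interior_gridRect Φ hΦ]
      exact ⟨_, hz, by simp⟩
    rw [mem_ball_zero_iff, Circle.norm_coe] at h1
    exact lt_irrefl _ h1
  let Q : LoopPartition α :=
    { base := gridPartition hM hN Φ hΦ
      map := fun w => F w
      map_boundary := fun w z h => by rw [← h, hFα z] }
  have hext : Q.IsExtension F := by
    refine ⟨fun w => rfl, hFα, fun c hc hs => ?_⟩
    have hγc : ContinuousOn (fun t => Φ.symm (c t)) (Icc 0 1) :=
      Φ.symm.continuous.comp_continuousOn hc.continuousOn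
    have hγi : InjOn (fun t => Φ.symm (c t)) (Icc 0 1) := fun s hs t ht h =>
      hc.injOn hs ht (Φ.symm.injective h)
    have hmono : ∀ {a D : ℝ} {w : ℝ → ℝ}, 0 ≤ D → ContinuousOn w (Icc 0 1) →
        InjOn w (Icc 0 1) → MonotoneOn (fun t => (w t - a) * D) (Icc 0 1) ∨
          AntitoneOn (fun t => (w t - a) * D) (Icc 0 1) := by
      intro a D w hD hwc hwi
      rcases hwc.strictMonoOn_of_injOn_Icc' zero_le_one hwi with h | h
      · exact Or.inl fun s hs t ht hst => by
          have := h.monotoneOn hs ht hst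
          dsimp only; gcongr
      · exact Or.inr fun s hs t ht hst => by
          have := h.antitoneOn hs ht hst
          dsimp only; gcongr
    rcases isEdge_gridPartition hM hN Φ hΦ hc hs with ⟨i, j, hi, hj0, hj, hm⟩ | ⟨i, j, hi0, hi, hj, hm⟩
    · have hsnd : ∀ t ∈ Icc (0 : ℝ) 1, Φ.symm (c t) = ((Φ.symm (c t)).1, (j : ℝ)) := fun t ht =>
        Prod.ext rfl (hm ht).2
      have hc1 : ContinuousOn (fun t => (Φ.symm (c t)).1) (Icc 0 1) :=
        continuous_fst.comp_continuousOn hγc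
      refine (hgeo (v i j) (v (i + 1) j)).exists_subarc (P := fun t => F (c t))
        (u := fun t => ((Φ.symm (c t)).1 - i) * dist (v i j) (v (i + 1) j)) (by fun_prop)
        (hmono dist_nonneg hc1 ?_) ?_ ?_
      · intro s hs t ht h
        refine hγi hs ht ?_
        dsimp only at h ⊢
        rw [hsnd s hs, hsnd t ht, h]
      · intro t ht
        have := (hm ht).1
        exact ⟨mul_nonneg (by linarith [this.1]) dist_nonneg,
          mul_le_of_le_one_left dist_nonneg (by linarith [this.2])⟩
      · intro t ht
        simp only [hF, hG]
        rw [hsnd t ht, gridMap_horizontal hgeo hv hi hj0 hj (hm ht).1]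
    · have hfst : ∀ t ∈ Icc (0 : ℝ) 1, Φ.symm (c t) = ((i : ℝ), (Φ.symm (c t)).2) := fun t ht =>
        Prod.ext (hm ht).1 rfl
      have hc2 : ContinuousOn (fun t => (Φ.symm (c t)).2) (Icc 0 1) :=
        continuous_snd.comp_continuousOn hγc
      refine (hgeo (v i j) (v i (j + 1))).exists_subarc (P := fun t => F (c t))
        (u := fun t => ((Φ.symm (c t)).2 - j) * dist (v i j) (v i (j + 1))) (by fun_prop)
        (hmono dist_nonneg hc2 ?_) ?_ ?_
      · intro s hs t ht h
        refine hγi hs ht ?_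
        dsimp only at h ⊢
        rw [hfst s hs, hfst t ht, h]
      · intro t ht
        have := (hm ht).2
        exact ⟨mul_nonneg (by linarith [this.1]) dist_nonneg,
          mul_le_of_le_one_left dist_nonneg (by linarith [this.2])⟩
      · intro t ht
        simp only [hF, hG]
        rw [hfst t ht, gridMap_vertical hgeo hv hi0 hi hj (hm ht).2]
  have hmesh : Q.mesh F ≤ ENNReal.ofReal (4 * r) := by
    refine iSup_le fun k => ?_
    let q : Fin M × Fin N := (finProdFinEquiv (m := M) (n := N)).symm k
    obtain ⟨i, hi⟩ : ∃ i : ℕ, i = q.1 := ⟨_, rfl⟩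
    obtain ⟨j, hj⟩ : ∃ j : ℕ, j = q.2 := ⟨_, rfl⟩
    have hiM : i < M := hi ▸ q.1.2
    have hjN : j < N := hj ▸ q.2.2
    have hpi := Real.pi_pos
    have hscale : ∀ t ∈ Icc (0 : ℝ) (2 * Real.pi), 2 / Real.pi * t ∈ Icc (0 : ℝ) 4 := fun t ht => by
      refine ⟨by have := ht.1; positivity, ?_⟩
      rw [div_mul_eq_mul_div, div_le_iff₀ hpi]; linarith [ht.2]
    have hend : 2 / Real.pi * (2 * Real.pi) = 4 := by field_simp; norm_num
    obtain ⟨φ, hφ, hφr, hφi⟩ := exists_circle_lift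
      (c := fun t => Φ (((i : ℝ), (j : ℝ)) + perimeter (2 / Real.pi * t)))
      (by have := continuous_perimeter; fun_prop)
      (by
        rw [hend, mul_zero, perimeter_bottom le_rfl zero_le_one, perimeter_left (by norm_num) le_rfl]
        norm_num)
    have himg : range φ = frontier (Q.base.disc k) := by
      have e0 : Q.base.disc k = Φ '' gridCell i j := by rw [hi, hj]; rfl
      have e1 : gridCell i j = Homeomorph.addLeft ((i : ℝ), (j : ℝ)) ''
          (Icc (0 : ℝ) 1 ×ˢ Icc (0 : ℝ) 1) := by
        ext ⟨x, y⟩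
        simp only [gridCell, Homeomorph.coe_addLeft, image_add_left, mem_preimage, mem_prod, mem_Icc,
          Prod.fst_add, Prod.snd_add, Prod.fst_neg, Prod.snd_neg]
        constructor <;> rintro ⟨⟨_, _⟩, _, _⟩ <;> refine ⟨⟨?_, ?_⟩, ?_, ?_⟩ <;> linarith
      rw [e0, hφr, e1, ← Φ.image_frontier, ← Homeomorph.image_frontier, ← image_perimeter, image_image,
        image_image]
      ext z
      constructor
      · rintro ⟨t, ht, rfl⟩
        exact ⟨_, hscale t ht, rfl⟩
      · rintro ⟨s, hs, rfl⟩
        refine ⟨Real.pi / 2 * s, ⟨by have := hs.1; positivity, ?_⟩, ?_⟩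
        · nlinarith [hs.2]
        · have : 2 / Real.pi * (Real.pi / 2 * s) = s := by field_simp
          simp [this]
    refine (iInf₂_le φ ?_).trans ((iInf_le _ himg).trans ?_)
    · refine hφi fun s hs t ht h => ?_
      have h1 := add_left_cancel (Φ.injective h)
      have key : ∀ t ∈ Ico (0 : ℝ) (2 * Real.pi), 2 / Real.pi * t ∈ Ico (0 : ℝ) 4 := fun t ht => by
        refine ⟨(hscale t (Ico_subset_Icc_self ht)).1, ?_⟩
        rw [div_mul_eq_mul_div, div_lt_iff₀ hpi]; linarith [ht.2]
      have h2 := perimeter_injOn (key s hs) (key t ht) h1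
      exact mul_left_cancel₀ (by positivity) h2
    · rw [loopLength]
      have e2 : EqOn (fun t : ℝ => F (φ (Circle.exp t)))
          ((fun s => G (((i : ℝ), (j : ℝ)) + perimeter s)) ∘ fun t => 2 / Real.pi * t)
          (Icc 0 (2 * Real.pi)) := fun t ht => by
        simp [hF, hφ t ht]
      rw [eVariationOn.congr e2]
      refine (eVariationOn.comp_le_of_monotoneOn _ _
        (fun s _ t _ h => mul_le_mul_of_nonneg_left h (by positivity)) hscale).trans ?_
      refine eVariationOn_perimeter_le hr ?_ ?_
      · rintro y (rfl | rfl) s hs t ht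
        · exact dist_gridMap_horizontal_le hgeo hv hh hb hiM hjN.le hs ht
        · have := dist_gridMap_horizontal_le hgeo hv hh hb hiM (Nat.succ_le_of_lt hjN) hs ht
          simpa using this
      · rintro x (rfl | rfl) s hs t ht
        · exact dist_gridMap_vertical_le hgeo hv hh' hb' hiM.le hjN hs ht
        · have := dist_gridMap_vertical_le hgeo hv hh' hb' (Nat.succ_le_of_lt hiM) hjN hs ht
          simpa using this
  exact iInf₂_le Q ⟨F, hext, hmesh.trans_lt hδ⟩
end geodesic

/-- Every parametrization of the unit circle by the perimeter of a rectangle extends to a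
homeomorphism of the plane that maps the rectangle onto the disc. -/
theorem exists_homeomorph_rect_disc {M N : ℕ} (hM : 0 < M) (hN : 0 < N) {τ : ℝ → ℝ}
    (hτc : ContinuousOn τ (Icc 0 4)) (hτm : StrictMonoOn τ (Icc 0 4)) (hτ0 : τ 0 = 0)
    (hτ4 : τ 4 = 2 * Real.pi) :
    ∃ Φ : (ℝ × ℝ) ≃ₜ ℂ, Φ '' gridRect M N = Metric.closedBall (0 : ℂ) 1 ∧
      ∀ t ∈ Icc (0 : ℝ) 4, Φ (M * (perimeter t).1, N * (perimeter t).2) = Circle.exp (τ t) := by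
  have hpi := Real.pi_pos
  have hM' : (0 : ℝ) < M := by exact_mod_cast hM
  have hN' : (0 : ℝ) < N := by exact_mod_cast hN
  -- `S` scales the rectangle to the unit square and `B` maps that to the unit ball of the sup norm.
  let B : (ℝ × ℝ) ≃ₜ (ℝ × ℝ) :=
    { toFun := fun p => (2 * p.1 - 1, 2 * p.2 - 1)
      invFun := fun p => ((p.1 + 1) / 2, (p.2 + 1) / 2)
      left_inv := fun p => by ext <;> simp
      right_inv := fun p => by ext <;> simp <;> ring
      continuous_toFun := by fun_prop
      continuous_invFun := by fun_prop }
  let S : (ℝ × ℝ) ≃ₜ (ℝ × ℝ) :=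
    { toFun := fun p => (p.1 / M, p.2 / N)
      invFun := fun p => (M * p.1, N * p.2)
      left_inv := fun p => by ext <;> simp <;> field_simp
      right_inv := fun p => by ext <;> simp <;> field_simp
      continuous_toFun := by fun_prop
      continuous_invFun := by fun_prop }
  have hBu : B '' (Icc (0 : ℝ) 1 ×ˢ Icc (0 : ℝ) 1) = Metric.closedBall 0 1 := by
    have : (0 : ℝ × ℝ) = (0, 0) := rfl
    rw [this, ← closedBall_prod_same, Real.closedBall_eq_Icc]
    ext ⟨x, y⟩
    rw [← B.preimage_symm]
    change (((x + 1) / 2, (y + 1) / 2) : ℝ × ℝ) ∈ Icc (0 : ℝ) 1 ×ˢ Icc (0 : ℝ) 1 ↔ _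
    simp only [mem_prod, mem_Icc]
    constructor <;> rintro ⟨⟨h1, h2⟩, h3, h4⟩ <;> refine ⟨⟨?_, ?_⟩, ?_, ?_⟩ <;> linarith
  have hBs : B '' (perimeter '' Icc 0 4) = Metric.sphere 0 1 := by
    rw [image_perimeter, B.image_frontier, hBu, frontier_closedBall _ one_ne_zero]
  have hscale : ∀ t ∈ Icc (0 : ℝ) (2 * Real.pi), 2 / Real.pi * t ∈ Icc (0 : ℝ) 4 := fun t ht => by
    refine ⟨by have := ht.1; positivity, ?_⟩
    rw [div_mul_eq_mul_div, div_le_iff₀ hpi]; linarith [ht.2]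
  have hscale' : ∀ t ∈ Ico (0 : ℝ) (2 * Real.pi), 2 / Real.pi * t ∈ Ico (0 : ℝ) 4 := fun t ht => by
    refine ⟨(hscale t (Ico_subset_Icc_self ht)).1, ?_⟩
    rw [div_mul_eq_mul_div, div_lt_iff₀ hpi]; linarith [ht.2]
  have hunscale : ∀ t ∈ Icc (0 : ℝ) 4, Real.pi / 2 * t ∈ Icc (0 : ℝ) (2 * Real.pi) ∧
      2 / Real.pi * (Real.pi / 2 * t) = t := fun t ht =>
    ⟨⟨by have := ht.1; positivity, by nlinarith [ht.2]⟩, by field_simp⟩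
  have hend : 2 / Real.pi * (2 * Real.pi) = 4 := by field_simp; norm_num
  have h04 : perimeter 0 = perimeter 4 := by
    rw [perimeter_bottom le_rfl zero_le_one, perimeter_left (by norm_num) le_rfl]; norm_num
  have hclampI : ∀ t : ℝ, max 0 (min 4 t) ∈ Icc (0 : ℝ) 4 := fun t =>
    ⟨le_max_left _ _, max_le (by norm_num) (min_le_left _ _)⟩
  have hclamp : ∀ t ∈ Icc (0 : ℝ) 4, max 0 (min 4 t) = t := fun t ht => by
    rw [min_eq_right ht.2, max_eq_right ht.1]
  obtain ⟨κ, hκ, hκr, hκi⟩ := exists_circle_lift (Z := Metric.sphere (0 : ℝ × ℝ) 1)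
    (c := fun t => ⟨B (perimeter (max 0 (min 4 (2 / Real.pi * t)))), by
      rw [← hBs]; exact mem_image_of_mem _ (mem_image_of_mem _ (hclampI _))⟩)
    (by
      have := continuous_perimeter
      exact (Continuous.subtype_mk (by fun_prop) _).continuousOn)
    (by
      apply Subtype.ext
      dsimp only
      rw [hend, mul_zero, hclamp 0 (by norm_num), hclamp 4 (by norm_num), h04])
  obtain ⟨χ, hχ, hχr, hχi⟩ := exists_circle_lift (Z := Metric.sphere (0 : ℂ) 1)
    (c := fun t => ⟨Circle.exp (τ (2 / Real.pi * t)), by simp⟩)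
    (by
      have h1 : ContinuousOn (fun t => τ (2 / Real.pi * t)) (Icc 0 (2 * Real.pi)) :=
        hτc.comp (by fun_prop) hscale
      rw [Topology.IsInducing.subtypeVal.continuousOn_iff]
      exact ((show Continuous ((↑) : Circle → ℂ) by fun_prop).comp Circle.exp.continuous).comp_continuousOn h1)
    (by
      apply Subtype.ext
      dsimp only
      rw [hend, mul_zero, hτ0, hτ4]; simp)
  have hκb : Function.Bijective κ := by
    constructor
    · refine hκi fun s hs t ht h => ?_
      have h1 := B.injective (congrArg Subtype.val h)
      rw [hclamp _ (hscale s (Ico_subset_Icc_self hs)),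
        hclamp _ (hscale t (Ico_subset_Icc_self ht))] at h1
      exact mul_left_cancel₀ (by positivity) (perimeter_injOn (hscale' s hs) (hscale' t ht) h1)
    · rw [← range_eq_univ, hκr, eq_univ_iff_forall]
      rintro ⟨z, hz⟩
      rw [← hBs] at hz
      obtain ⟨_, ⟨t, ht, rfl⟩, rfl⟩ := hz
      refine ⟨_, (hunscale t ht).1, Subtype.ext ?_⟩
      dsimp only
      rw [(hunscale t ht).2, hclamp t ht]
  have hχb : Function.Bijective χ := by
    constructor
    · refine hχi fun s hs t ht h => ?_
      have h1 : Circle.exp (τ (2 / Real.pi * s)) = Circle.exp (τ (2 / Real.pi * t)) :=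
        Circle.ext (congrArg Subtype.val h)
      have key : ∀ t ∈ Ico (0 : ℝ) 4, 0 ≤ τ t ∧ τ t < 2 * Real.pi := fun t ht => by
        rw [← hτ4, ← hτ0]
        exact ⟨hτm.monotoneOn (by norm_num) (Ico_subset_Icc_self ht) ht.1,
          hτm (Ico_subset_Icc_self ht) (by norm_num) ht.2⟩
      obtain ⟨m, hm⟩ := Circle.exp_eq_exp.1 h1
      have ks := key _ (hscale' s hs)
      have kt := key _ (hscale' t ht)
      have hm0 : m = 0 := by
        have a1 : (m : ℝ) < 1 := by by_contra h; push Not at h; nlinarith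
        have a2 : (-1 : ℝ) < m := by by_contra h; push Not at h; nlinarith
        have a1' : m < 1 := by exact_mod_cast a1
        have a2' : -1 < m := by exact_mod_cast a2
        omega
      rw [hm0, Int.cast_zero, zero_mul, add_zero] at hm
      exact mul_left_cancel₀ (by positivity)
        (hτm.injOn (hscale s (Ico_subset_Icc_self hs)) (hscale t (Ico_subset_Icc_self ht)) hm)
    · rw [← range_eq_univ, hχr, eq_univ_iff_forall]
      rintro ⟨z, hz⟩
      obtain ⟨u, hu, he⟩ := exists_circle_exp_eq ⟨z, hz⟩
      obtain ⟨t, ht, hte⟩ := intermediate_value_Icc (by norm_num : (0 : ℝ) ≤ 4) hτc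
        (show u ∈ Icc (τ 0) (τ 4) by rw [hτ0, hτ4]; exact Ico_subset_Icc_self hu)
      refine ⟨_, (hunscale t ht).1, Subtype.ext ?_⟩
      dsimp only
      rw [(hunscale t ht).2, hte, he]
  let κ' : Circle ≃ₜ Metric.sphere (0 : ℝ × ℝ) 1 :=
    Continuous.homeoOfEquivCompactToT2 (f := Equiv.ofBijective κ hκb) κ.continuous
  let χ' : Circle ≃ₜ Metric.sphere (0 : ℂ) 1 :=
    Continuous.homeoOfEquivCompactToT2 (f := Equiv.ofBijective χ hχb) χ.continuous
  let Φ : (ℝ × ℝ) ≃ₜ ℂ := S.trans (B.trans (radialHomeomorph (κ'.symm.trans χ')))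
  have hnorm : ∀ p, ‖Φ p‖ = ‖B (S p)‖ := fun p => norm_radialExtension _ _
  refine ⟨Φ, ?_, fun t ht => ?_⟩
  · ext z
    obtain ⟨p, rfl⟩ := Φ.surjective z
    rw [Φ.injective.mem_set_image, mem_closedBall_zero_iff, hnorm, ← mem_closedBall_zero_iff, ← hBu,
      B.injective.mem_set_image]
    have hS : S p = (p.1 / M, p.2 / N) := rfl
    rw [hS]
    simp only [gridRect, mem_prod, mem_Icc]
    rw [div_le_one hM', div_le_one hN', le_div_iff₀ hM', le_div_iff₀ hN', zero_mul, zero_mul]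
  · have hS : S (M * (perimeter t).1, N * (perimeter t).2) = perimeter t := S.apply_symm_apply _
    have h1 : κ' (Circle.exp (Real.pi / 2 * t)) = ⟨B (perimeter t), by
        rw [← hBs]; exact mem_image_of_mem _ (mem_image_of_mem _ ht)⟩ := by
      change κ _ = _
      rw [hκ _ (hunscale t ht).1]
      apply Subtype.ext
      dsimp only
      rw [(hunscale t ht).2, hclamp t ht]
    have h2 : (χ' (Circle.exp (Real.pi / 2 * t)) : ℂ) = Circle.exp (τ t) := by
      change (χ _ : ℂ) = _
      rw [hχ _ (hunscale t ht).1]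
      dsimp only
      rw [(hunscale t ht).2]
    change radialExtension _ (B (S _)) = _
    rw [hS]
    have h3 := radialExtension_sphere (κ'.symm.trans χ') (κ' (Circle.exp (Real.pi / 2 * t)))
    rw [Homeomorph.trans_apply, Homeomorph.symm_apply_apply, h2] at h3
    rw [h1] at h3
    exact h3

/-- A rectifiable loop has a Lipschitz parametrization `β` such that every sufficiently fine grid of
points whose lower side subdivides `β` and whose other three sides are constant gives a partition of
the loop into pieces of less than half of its length. -/
theorem exists_lipschitz_param_partitionNumber_le {X : Type*} [MetricSpace X]
    (hgeod : IsGeodesicSpace X) (α : C(Circle, X)) {L : ℝ}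
    (hα : loopLength α = ENNReal.ofReal L) (hL : 0 < L) :
    ∃ β : ℝ → X, β 0 = α 1 ∧ β (2 * L) = α 1 ∧
      (∀ s ∈ Icc 0 (2 * L), ∀ t ∈ Icc 0 (2 * L), dist (β s) (β t) ≤ |s - t|) ∧
      ∀ (M N : ℕ) (f : ℕ → ℕ → X) (r : ℝ), 0 < M → 0 < N → 2 * L / M ≤ r → 8 * r < L →
        (∀ i ≤ M, f i 0 = β (2 * L * (i / M))) → (∀ i ≤ M, f i N = α 1) →
        (∀ j ≤ N, f 0 j = α 1) → (∀ j ≤ N, f M j = α 1) →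
        (∀ i < M, ∀ j ≤ N, dist (f i j) (f (i + 1) j) ≤ r) →
        (∀ i ≤ M, ∀ j < N, dist (f i j) (f i (j + 1)) ≤ r) →
        partitionNumber α (loopLength α / 2) ≤ (M * N : ℕ) := by
  have hLt : (loopLength α).toReal = L := by rw [hα, ENNReal.toReal_ofReal hL.le]
  obtain ⟨θ, hθ0, hθL, hθ⟩ := exists_orderIso_lipschitz_reparam
    (f := fun t : ℝ => α (Circle.exp t)) (by fun_prop) Real.two_pi_pos
    (by change loopLength α ≠ ⊤; rw [hα]; exact ENNReal.ofReal_ne_top)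
    (by change 0 < (loopLength α).toReal; rwa [hLt])
  change θ (2 * (loopLength α).toReal) = _ at hθL
  change ∀ s ∈ Icc 0 (2 * (loopLength α).toReal), ∀ t ∈ Icc 0 (2 * (loopLength α).toReal), _ at hθ
  rw [hLt] at hθL hθ
  set β : ℝ → X := fun s => α (Circle.exp (θ s)) with hβ
  have hβ1 : β (2 * L) = α 1 := by simp [hβ, hθL]
  refine ⟨β, by simp [hβ, hθ0], hβ1, hθ, ?_⟩
  intro M N f r hM hN hMr hrL hf0 hfN hf0' hfM hh hh'
  have hM' : (0 : ℝ) < M := by exact_mod_cast hM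
  have hN' : (0 : ℝ) < N := by exact_mod_cast hN
  have hM1 : (1 : ℝ) ≤ M := by exact_mod_cast hM
  have hN1 : (1 : ℝ) ≤ N := by exact_mod_cast hN
  have hr : 0 < r := lt_of_lt_of_le (by positivity) hMr
  -- The lower side of the rectangle carries all of the loop except for an end of length `η`, which
  -- is spread over the other three sides.
  set η := (L - 8 * r) / 32 with hη
  have hη0 : 0 < η := by rw [hη]; linarith
  have hηL : η < L := by rw [hη]; linarith
  set pl : ℝ → ℝ := fun t => (2 * L - η) * min t 1 + η / 3 * max (t - 1) 0 with hpl
  have hpl_low : ∀ t ≤ (1 : ℝ), pl t = (2 * L - η) * t := fun t ht => by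
    simp only [hpl]; rw [min_eq_left ht, max_eq_right (by linarith)]; ring
  have hpl_high : ∀ t, (1 : ℝ) ≤ t → pl t = 2 * L - η + η / 3 * (t - 1) := fun t ht => by
    simp only [hpl]; rw [min_eq_right ht, max_eq_left (by linarith)]; ring
  have hplm : StrictMono pl := by
    intro s t hst
    rcases le_total t 1 with h | h
    · rw [hpl_low t h, hpl_low s (by linarith)]
      exact mul_lt_mul_of_pos_left hst (by linarith)
    · rw [hpl_high t h]
      rcases le_total s 1 with h' | h'
      · rw [hpl_low s h']
        rcases h.eq_or_lt with h1 | h1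
        · rw [← h1] at hst ⊢
          nlinarith
        · have : 0 < η / 3 * (t - 1) := mul_pos (by linarith) (by linarith)
          nlinarith
      · rw [hpl_high s h']
        have : 0 < η / 3 * (t - s) := mul_pos (by linarith) (by linarith)
        nlinarith
  have hplc : Continuous pl := by fun_prop
  have hpl0 : pl 0 = 0 := by rw [hpl_low 0 zero_le_one, mul_zero]
  have hpl4 : pl 4 = 2 * L := by rw [hpl_high 4 (by norm_num)]; ring
  have hplI : ∀ t ∈ Icc (0 : ℝ) 4, pl t ∈ Icc 0 (2 * L) := fun t ht => by
    rw [← hpl4, ← hpl0]; exact ⟨hplm.monotone ht.1, hplm.monotone ht.2⟩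
  obtain ⟨Φ, hΦ, hΦp⟩ := exists_homeomorph_rect_disc hM hN (τ := fun t => θ (pl t))
    (θ.continuous.comp hplc).continuousOn ((θ.strictMono.comp hplm).strictMonoOn _)
    (by rw [hpl0, hθ0]) (by rw [hpl4, hθL])
  classical
  let b : ℝ × ℝ → X := fun p => if h : ∃ z : Circle, (z : ℂ) = Φ p then α h.choose else α 1
  have hbz : ∀ (z : Circle) p, Φ p = z → b p = α z := fun z p h => by
    have hex : ∃ z : Circle, (z : ℂ) = Φ p := ⟨z, h.symm⟩
    have : hex.choose = z := Circle.ext (hex.choose_spec.trans h)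
    simp only [b, dif_pos hex, this]
  have hbp : ∀ t ∈ Icc (0 : ℝ) 4, b (M * (perimeter t).1, N * (perimeter t).2) = β (pl t) :=
    fun t ht => hbz _ _ (hΦp t ht)
  have hbB : ∀ x ∈ Icc (0 : ℝ) M, b (x, 0) = β ((2 * L - η) * (x / M)) := fun x hx => by
    have h0 : 0 ≤ x / M := div_nonneg hx.1 hM'.le
    have h1 : x / M ≤ 1 := (div_le_one hM').2 hx.2
    have := hbp (x / M) ⟨h0, by linarith⟩
    rw [perimeter_bottom h0 h1, hpl_low _ h1] at this
    rw [← this]; congr 1; ext <;> simp; field_simp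
  have hbR : ∀ y ∈ Icc (0 : ℝ) N, b (M, y) = β (2 * L - η + η / 3 * (y / N)) := fun y hy => by
    have h0 : 0 ≤ y / N := div_nonneg hy.1 hN'.le
    have h1 : y / N ≤ 1 := (div_le_one hN').2 hy.2
    have := hbp (1 + y / N) ⟨by linarith, by linarith⟩
    rw [perimeter_right (by linarith) (by linarith), hpl_high _ (by linarith)] at this
    rw [add_sub_cancel_left] at this
    rw [← this]; congr 1; ext <;> simp; field_simp
  have hbT : ∀ x ∈ Icc (0 : ℝ) M, b (x, N) = β (2 * L - η + η / 3 * (2 - x / M)) := fun x hx => by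
    have h0 : 0 ≤ x / M := div_nonneg hx.1 hM'.le
    have h1 : x / M ≤ 1 := (div_le_one hM').2 hx.2
    have := hbp (3 - x / M) ⟨by linarith, by linarith⟩
    rw [perimeter_top (by linarith) (by linarith), hpl_high _ (by linarith)] at this
    rw [show 2 - x / M = 3 - x / M - 1 by ring, ← this]; congr 1; ext <;> simp; field_simp
  have hbL : ∀ y ∈ Icc (0 : ℝ) N, b (0, y) = β (2 * L - η + η / 3 * (3 - y / N)) := fun y hy => by
    have h0 : 0 ≤ y / N := div_nonneg hy.1 hN'.le
    have h1 : y / N ≤ 1 := (div_le_one hN').2 hy.2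
    have := hbp (4 - y / N) ⟨by linarith, by linarith⟩
    rw [perimeter_left (by linarith) (by linarith), hpl_high _ (by linarith)] at this
    rw [show 3 - y / N = 4 - y / N - 1 by ring, ← this]; congr 1; ext <;> simp; field_simp
  have hend : ∀ a ∈ Icc (0 : ℝ) 3, 2 * L - η + η / 3 * a ∈ Icc 0 (2 * L) ∧
      dist (β (2 * L - η + η / 3 * a)) (α 1) ≤ η := fun a ha => by
    have h0 : 0 ≤ η / 3 * a := mul_nonneg (by linarith) ha.1
    have h1 : η / 3 * a ≤ η / 3 * 3 := mul_le_mul_of_nonneg_left ha.2 (by linarith)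
    have hm : 2 * L - η + η / 3 * a ∈ Icc 0 (2 * L) := ⟨by linarith, by linarith⟩
    refine ⟨hm, ?_⟩
    rw [← hβ1]
    refine (hθ _ hm _ ⟨by linarith, le_rfl⟩).trans ?_
    rw [abs_le]; constructor <;> linarith
  have hlow : ∀ a ∈ Icc (0 : ℝ) 1, (2 * L - η) * a ∈ Icc 0 (2 * L) := fun a ha =>
    ⟨mul_nonneg (by linarith) ha.1, by nlinarith [ha.1, ha.2]⟩
  let v : ℕ → ℕ → X := fun i j => if i = 0 ∨ i = M ∨ j = 0 ∨ j = N then b (i, j) else f i j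
  have hvf : ∀ i ≤ M, ∀ j ≤ N, dist (v i j) (f i j) ≤ η := by
    intro i hi j hj
    have hiM : (i : ℝ) ∈ Icc (0 : ℝ) M := ⟨Nat.cast_nonneg _, Nat.cast_le.2 hi⟩
    have hjN : (j : ℝ) ∈ Icc (0 : ℝ) N := ⟨Nat.cast_nonneg _, Nat.cast_le.2 hj⟩
    have hiM' : (i : ℝ) / M ∈ Icc (0 : ℝ) 1 := ⟨by positivity, (div_le_one hM').2 hiM.2⟩
    have hjN' : (j : ℝ) / N ∈ Icc (0 : ℝ) 1 := ⟨by positivity, (div_le_one hN').2 hjN.2⟩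
    simp only [v]
    split_ifs with h
    · rcases h with rfl | rfl | rfl | rfl
      · rw [hf0' j hj, Nat.cast_zero, hbL _ hjN]
        exact (hend _ ⟨by linarith [hjN'.2], by linarith [hjN'.1]⟩).2
      · rw [hfM j hj, hbR _ hjN]
        exact (hend _ ⟨by linarith [hjN'.1], by linarith [hjN'.2]⟩).2
      · rw [hf0 i hi, Nat.cast_zero, hbB _ hiM]
        refine (hθ _ (hlow _ hiM') _ ⟨mul_nonneg (by linarith) hiM'.1, ?_⟩).trans ?_
        · nlinarith [hiM'.2]
        · rw [show (2 * L - η) * ((i : ℝ) / M) - 2 * L * (i / M) = -(η * (i / M)) by ring, abs_neg,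
            abs_of_nonneg (mul_nonneg hη0.le hiM'.1)]
          exact mul_le_of_le_one_right hη0.le hiM'.2
      · rw [hfN i hi, hbT _ hiM]
        exact (hend _ ⟨by linarith [hiM'.2], by linarith [hiM'.1]⟩).2
    · rw [dist_self]; exact hη0.le
  have hadj : ∀ {i j k l : ℕ}, i ≤ M → j ≤ N → k ≤ M → l ≤ N → dist (f i j) (f k l) ≤ r →
      dist (v i j) (v k l) ≤ r + 2 * η := by
    intro i j k l hi hj hk hl h
    have h1 := hvf i hi j hj
    have h2 := hvf k hk l hl
    have h3 := dist_triangle4_right (v i j) (v k l) (f i j) (f k l)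
    linarith
  have hsmall : η / 3 ≤ r + 2 * η := by linarith
  have hdiv : ∀ {K : ℝ}, 1 ≤ K → ∀ s t : ℝ, |η / 3 * (s / K) - η / 3 * (t / K)| ≤
      (r + 2 * η) * |s - t| := by
    intro K hK s t
    rw [← mul_sub, ← sub_div, abs_mul, abs_of_pos (by linarith : 0 < η / 3), abs_div,
      abs_of_pos (by linarith : 0 < K)]
    have : |s - t| / K ≤ |s - t| := div_le_self (abs_nonneg _) hK
    gcongr
  refine partitionNumber_le_of_grid (b := b) (v := v) (r := r + 2 * η) hgeod α hM hN Φ hΦ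
    (by linarith) (fun z => hbz z _ (by simp)) ?_ ?_ ?_ ?_ ?_ ?_
  · intro i _ j _ h
    simp only [v, if_pos h]
  · intro i hi j hj
    exact hadj hi.le hj hi hj (hh i hi j hj)
  · intro i hi j hj
    exact hadj hi hj.le hi hj (hh' i hi j hj)
  · have key : ∀ i < M, ∀ s ∈ Icc (i : ℝ) (i + 1), s ∈ Icc (0 : ℝ) M ∧ s / M ∈ Icc (0 : ℝ) 1 := by
      intro i hi s hs
      have h0 : (0 : ℝ) ≤ i := Nat.cast_nonneg _
      have h1 : (i : ℝ) + 1 ≤ M := by exact_mod_cast hi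
      have h2 : s ∈ Icc (0 : ℝ) M := ⟨by linarith [hs.1], by linarith [hs.2]⟩
      exact ⟨h2, div_nonneg h2.1 hM'.le, (div_le_one hM').2 h2.2⟩
    rintro i hi j (rfl | rfl) s hs t ht
    · obtain ⟨hs1, hs2⟩ := key i hi s hs
      obtain ⟨ht1, ht2⟩ := key i hi t ht
      rw [Nat.cast_zero, hbB s hs1, hbB t ht1]
      refine (hθ _ (hlow _ hs2) _ (hlow _ ht2)).trans ?_
      rw [← mul_sub, ← sub_div, abs_mul, abs_div, abs_of_pos hM',
        abs_of_pos (by linarith : 0 < 2 * L - η), mul_div_assoc', mul_div_right_comm]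
      have : (2 * L - η) / M ≤ 2 * L / M := by gcongr; linarith
      gcongr
      linarith
    · obtain ⟨hs1, hs2⟩ := key i hi s hs
      obtain ⟨ht1, ht2⟩ := key i hi t ht
      rw [hbT s hs1, hbT t ht1]
      refine (hθ _ (hend _ ⟨by linarith [hs2.2], by linarith [hs2.1]⟩).1 _
        (hend _ ⟨by linarith [ht2.2], by linarith [ht2.1]⟩).1).trans ?_
      rw [abs_sub_comm s t]
      refine le_trans (le_of_eq ?_) (hdiv hM1 t s)
      congr 1; ring
  · have key : ∀ i < N, ∀ s ∈ Icc (i : ℝ) (i + 1), s ∈ Icc (0 : ℝ) N ∧ s / N ∈ Icc (0 : ℝ) 1 := by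
      intro i hi s hs
      have h0 : (0 : ℝ) ≤ i := Nat.cast_nonneg _
      have h1 : (i : ℝ) + 1 ≤ N := by exact_mod_cast hi
      have h2 : s ∈ Icc (0 : ℝ) N := ⟨by linarith [hs.1], by linarith [hs.2]⟩
      exact ⟨h2, div_nonneg h2.1 hN'.le, (div_le_one hN').2 h2.2⟩
    rintro j hj i (rfl | rfl) s hs t ht
    · obtain ⟨hs1, hs2⟩ := key j hj s hs
      obtain ⟨ht1, ht2⟩ := key j hj t ht
      rw [Nat.cast_zero, hbL s hs1, hbL t ht1]
      refine (hθ _ (hend _ ⟨by linarith [hs2.2], by linarith [hs2.1]⟩).1 _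
        (hend _ ⟨by linarith [ht2.2], by linarith [ht2.1]⟩).1).trans ?_
      rw [abs_sub_comm s t]
      refine le_trans (le_of_eq ?_) (hdiv hN1 t s)
      congr 1; ring
    · obtain ⟨hs1, hs2⟩ := key j hj s hs
      obtain ⟨ht1, ht2⟩ := key j hj t ht
      rw [hbR s hs1, hbR t ht1]
      refine (hθ _ (hend _ ⟨by linarith [hs2.1], by linarith [hs2.2]⟩).1 _
        (hend _ ⟨by linarith [ht2.1], by linarith [ht2.2]⟩).1).trans ?_
      refine le_trans (le_of_eq ?_) (hdiv hN1 s t)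
      congr 1; ring
  · rw [hα, ← ENNReal.ofReal_ofNat 2, ← ENNReal.ofReal_div_of_pos two_pos]
    exact (ENNReal.ofReal_lt_ofReal_iff (by linarith)).2 (by rw [hη]; linarith)

/-! ### Homotopy of loops at every positive scale -/

section fine
open scoped unitInterval
variable {Y : Type*} [MetricSpace Y] {p : Y}

/-- A map `f : I → Y`, not necessarily continuous, is a `δ`-loop at `p` if it sends the endpoints to
`p` and sufficiently close points to points at distance less than `δ`. -/
def IsFineLoop (p : Y) (δ : ℝ) (f : I → Y) : Prop :=
  f 0 = p ∧ f 1 = p ∧ ∃ η > 0, ∀ s t : I, dist s t < η → dist (f s) (f t) < δ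

/-- Two `δ`-loops that are uniformly `δ`-close. -/
def FineStep (p : Y) (δ : ℝ) (f g : I → Y) : Prop :=
  IsFineLoop p δ f ∧ IsFineLoop p δ g ∧ ∀ t, dist (f t) (g t) < δ

/-- Loops at `p` that are, for every `δ > 0`, joined by a finite chain of `δ`-loops in which
successive loops are uniformly `δ`-close. -/
def FinelyHomotopic (γ γ' : Path p p) : Prop :=
  ∀ δ > 0, Relation.ReflTransGen (FineStep p δ) γ γ'

theorem FineStep.symm {δ : ℝ} {f g : I → Y} (h : FineStep p δ f g) : FineStep p δ g f :=
  ⟨h.2.1, h.1, fun t => by rw [dist_comm]; exact h.2.2 t⟩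

theorem reflTransGen_fineStep_symm {δ : ℝ} {f g : I → Y}
    (h : Relation.ReflTransGen (FineStep p δ) f g) : Relation.ReflTransGen (FineStep p δ) g f :=
  (@Relation.ReflTransGen.stdSymm _ _ ⟨fun _ _ => FineStep.symm⟩).symm _ _ h

namespace FinelyHomotopic
variable {γ γ' γ'' : Path p p}

theorem symm (h : FinelyHomotopic γ γ') : FinelyHomotopic γ' γ :=
  fun δ hδ => reflTransGen_fineStep_symm (h δ hδ)

theorem trans (h : FinelyHomotopic γ γ') (h' : FinelyHomotopic γ' γ'') :
    FinelyHomotopic γ γ'' := fun δ hδ => (h δ hδ).trans (h' δ hδ)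

end FinelyHomotopic

theorem Path.isFineLoop (γ : Path p p) {δ : ℝ} (hδ : 0 < δ) : IsFineLoop p δ γ := by
  refine ⟨γ.source, γ.target, ?_⟩
  obtain ⟨η, hη, h⟩ := Metric.uniformContinuous_iff.1
    (CompactSpace.uniformContinuous_of_continuous γ.continuous) δ hδ
  exact ⟨η, hη, fun s t hst => h hst⟩

theorem Path.Homotopic.finelyHomotopic {γ γ' : Path p p} (h : γ.Homotopic γ') :
    FinelyHomotopic γ γ' := by
  intro δ hδ
  obtain ⟨F⟩ := h
  have hsymm : Std.Symm fun s t : I =>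
      Relation.ReflTransGen (FineStep p δ) (F.eval s) (F.eval t) :=
    ⟨fun _ _ => reflTransGen_fineStep_symm⟩
  have key := PreconnectedSpace.induction₂
    (fun s t : I => Relation.ReflTransGen (FineStep p δ) (F.eval s) (F.eval t)) ?_
    ⟨fun _ _ _ => Relation.ReflTransGen.trans⟩ 0 1
  · rwa [F.eval_zero, F.eval_one] at key
  · intro s
    obtain ⟨η, hη, hF⟩ := Metric.uniformContinuous_iff.1
      (CompactSpace.uniformContinuous_of_continuous F.continuous) δ hδ
    filter_upwards [Metric.ball_mem_nhds s hη] with s' hs'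
    refine Relation.ReflTransGen.single
      ⟨(F.eval s).isFineLoop hδ, (F.eval s').isFineLoop hδ, fun t => ?_⟩
    refine hF (a := (s, t)) (b := (s', t)) ?_
    rw [Prod.dist_eq, dist_self, dist_comm]
    exact max_lt hs' hη

/-- The concatenation of two maps on the unit interval. On the maps underlying two paths it is by
definition the map underlying `Path.trans`. -/
def concatFun (f g : I → Y) (t : I) : Y :=
  if (t : ℝ) ≤ 1 / 2 then IccExtend zero_le_one f (2 * t) else IccExtend zero_le_one g (2 * t - 1)

theorem IsFineLoop.mono {δ δ' : ℝ} (h : δ ≤ δ') {f : I → Y} (hf : IsFineLoop p δ f) :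
    IsFineLoop p δ' f := by
  obtain ⟨h0, h1, η, hη, h2⟩ := hf
  exact ⟨h0, h1, η, hη, fun s t hst => (h2 s t hst).trans_le h⟩

theorem IsFineLoop.exists_IccExtend {δ : ℝ} {f : I → Y} (hf : IsFineLoop p δ f) :
    (∀ x ≤ 0, IccExtend zero_le_one f x = p) ∧ (∀ x ≥ 1, IccExtend zero_le_one f x = p) ∧
      ∃ η > 0, ∀ x y : ℝ, |x - y| < η →
        dist (IccExtend zero_le_one f x) (IccExtend zero_le_one f y) < δ := by
  obtain ⟨h0, h1, η, hη, h⟩ := hf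
  refine ⟨fun x hx => ?_, fun x hx => ?_, η, hη, fun x y hxy => ?_⟩
  · rw [IccExtend_of_le_left _ _ hx]; exact h0
  · rw [IccExtend_of_right_le _ _ hx]; exact h1
  · refine h _ _ (lt_of_le_of_lt ?_ hxy)
    have := (LipschitzWith.projIcc (zero_le_one (α := ℝ))).dist_le_mul x y
    simpa [Real.dist_eq] using this

theorem IsFineLoop.concat {δ : ℝ} {f g : I → Y} (hf : IsFineLoop p (δ / 2) f)
    (hg : IsFineLoop p (δ / 2) g) (hδ : 0 < δ) : IsFineLoop p δ (concatFun f g) := by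
  obtain ⟨f0, f1, η, hη, hf⟩ := hf.exists_IccExtend
  obtain ⟨g0, g1, η', hη', hg⟩ := hg.exists_IccExtend
  refine ⟨?_, ?_, min η η' / 2, by positivity, ?_⟩
  · rw [concatFun, if_pos (by simp)]; exact f0 _ (by simp)
  · rw [concatFun, if_neg (by norm_num)]; exact g1 _ (by norm_num)
  · have key : ∀ s t : I, (s : ℝ) ≤ t → dist s t < min η η' / 2 →
        dist (concatFun f g s) (concatFun f g t) < δ := by
      intro s t hle hst
      rw [Subtype.dist_eq, Real.dist_eq, abs_sub_comm, abs_of_nonneg (by linarith)] at hst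
      have h1 : 2 * ((t : ℝ) - s) < η := by linarith [min_le_left η η']
      have h2 : 2 * ((t : ℝ) - s) < η' := by linarith [min_le_right η η']
      unfold concatFun
      split_ifs with hs ht ht
      · refine (hf _ _ ?_).trans (by linarith)
        rw [abs_sub_comm, abs_of_nonneg (by linarith)]; linarith
      · have e1 := hf (2 * s) 1 (by
          rw [abs_sub_comm, abs_of_nonneg (by linarith)]; linarith)
        have e2 := hg 0 (2 * t - 1) (by
          rw [abs_sub_comm, abs_of_nonneg (by linarith)]; linarith)
        rw [f1 1 le_rfl] at e1
        rw [g0 0 le_rfl] at e2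
        linarith [dist_triangle (IccExtend zero_le_one f (2 * (s : ℝ))) p
          (IccExtend zero_le_one g (2 * (t : ℝ) - 1))]
      · linarith
      · refine (hg _ _ ?_).trans (by linarith)
        rw [abs_sub_comm, abs_of_nonneg (by linarith)]; linarith
    intro s t hst
    rcases le_total (s : ℝ) t with h | h
    · exact key s t h hst
    · rw [dist_comm] at hst ⊢
      exact key t s h hst

namespace FinelyHomotopic
variable {γ γ' κ : Path p p}

theorem trans_congr_right (κ : Path p p) (h : FinelyHomotopic γ γ') :
    FinelyHomotopic (κ.trans γ) (κ.trans γ') := by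
  intro δ hδ
  have hδ2 : 0 < δ / 2 := by positivity
  refine Relation.ReflTransGen.lift (concatFun κ) (fun f g hfg => ?_) _ _ (h (δ / 2) hδ2)
  refine ⟨(κ.isFineLoop hδ2).concat hfg.1 hδ, (κ.isFineLoop hδ2).concat hfg.2.1 hδ, fun t => ?_⟩
  unfold concatFun
  split_ifs with ht
  · rwa [dist_self]
  · exact (hfg.2.2 _).trans (by linarith)

theorem trans_congr_left (κ : Path p p) (h : FinelyHomotopic γ γ') :
    FinelyHomotopic (γ.trans κ) (γ'.trans κ) := by
  intro δ hδ
  have hδ2 : 0 < δ / 2 := by positivity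
  refine Relation.ReflTransGen.lift (fun f => concatFun f κ) (fun f g hfg => ?_) _ _ (h (δ / 2) hδ2)
  refine ⟨hfg.1.concat (κ.isFineLoop hδ2) hδ, hfg.2.1.concat (κ.isFineLoop hδ2) hδ, fun t => ?_⟩
  dsimp only [concatFun]
  split_ifs with ht
  · exact (hfg.2.2 _).trans (by linarith)
  · rwa [dist_self]

theorem trans_left_cancel (h : FinelyHomotopic (κ.trans γ) (κ.trans γ')) :
    FinelyHomotopic γ γ' := by
  have key : ∀ τ : Path p p, (κ.symm.trans (κ.trans τ)).Homotopic τ := fun τ =>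
    (Path.Homotopic.symm ⟨Path.Homotopy.transAssoc κ.symm κ τ⟩).trans
      ((Path.Homotopic.hcomp ⟨(Path.Homotopy.reflSymmTrans κ).symm⟩ (Path.Homotopic.refl τ)).trans
        ⟨Path.Homotopy.reflTrans τ⟩)
  exact (key γ).symm.finelyHomotopic.trans
    ((h.trans_congr_right κ.symm).trans (key γ').finelyHomotopic)

theorem trans_right_cancel (h : FinelyHomotopic (γ.trans κ) (γ'.trans κ)) :
    FinelyHomotopic γ γ' := by
  have key : ∀ τ : Path p p, ((τ.trans κ).trans κ.symm).Homotopic τ := fun τ =>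
    (show Path.Homotopic _ _ from ⟨Path.Homotopy.transAssoc τ κ κ.symm⟩).trans
      ((Path.Homotopic.hcomp (Path.Homotopic.refl τ)
        ⟨(Path.Homotopy.reflTransSymm κ).symm⟩).trans ⟨Path.Homotopy.transRefl τ⟩)
  exact (key γ).symm.finelyHomotopic.trans
    ((h.trans_congr_left κ.symm).trans (key γ').finelyHomotopic)

end FinelyHomotopic

/-! ### Infinite products of loops -/

/-- The loops `h k` at `p` shrink to `p`. -/
def ShrinkingLoops (h : ℕ → Path p p) (r : ℕ → ℝ) : Prop :=
  Antitone r ∧ Tendsto r atTop (𝓝 0) ∧ ∀ k t, dist (h k t) p ≤ r k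

theorem ShrinkingLoops.shift {h : ℕ → Path p p} {r : ℕ → ℝ} (H : ShrinkingLoops h r) :
    ShrinkingLoops (fun k => h (k + 1)) (fun k => r (k + 1)) :=
  ⟨fun _ _ hab => H.1 (Nat.succ_le_succ hab), (tendsto_add_atTop_iff_nat 1).2 H.2.1,
    fun k t => H.2.2 (k + 1) t⟩

theorem ShrinkingLoops.nonneg {h : ℕ → Path p p} {r : ℕ → ℝ} (H : ShrinkingLoops h r) (k : ℕ) :
    0 ≤ r k := dist_nonneg.trans (H.2.2 k 0)

/-- The product of the first `m` of the loops `h 0, h 1, …`, bracketed to the right. -/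
def partialProduct : ℕ → (ℕ → Path p p) → Path p p
  | 0, _ => Path.refl p
  | m + 1, h => (h 0).trans (partialProduct m fun k => h (k + 1))

/-- The value at time `t` of the infinite product of the loops `h 0, h 1, …`: the `k`-th loop is run
through between the times `1 - 2⁻ᵏ` and `1 - 2⁻⁽ᵏ⁺¹⁾`, so that the first `⌈1 / (1 - t)⌉` loops
determine the value at `t < 1`. At `t = 1` the bound is `0` and the value is the base point. -/
def infiniteProductFun (h : ℕ → Path p p) (t : I) : Y :=
  partialProduct ⌈1 / (1 - (t : ℝ))⌉₊ h t

theorem partialProduct_succ_of_le (h : ℕ → Path p p) (m : ℕ) {t : I} (ht : (t : ℝ) ≤ 1 / 2) :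
    partialProduct (m + 1) h t = (h 0).extend (2 * t) := if_pos ht

theorem partialProduct_succ_of_not_le (h : ℕ → Path p p) (m : ℕ) {t : I}
    (ht : ¬ (t : ℝ) ≤ 1 / 2) :
    partialProduct (m + 1) h t = partialProduct m (fun k => h (k + 1))
      ⟨2 * t - 1, by linarith, by linarith [t.2.2]⟩ := by
  rw [partialProduct, Path.trans_apply, dif_neg ht]

/-- At a time `t ≤ 1 - 2⁻ᵐ` only the first `m` loops matter. -/
theorem partialProduct_eq_of_le (m : ℕ) (h : ℕ → Path p p) (t : I)
    (ht : 1 ≤ (1 - (t : ℝ)) * 2 ^ m) (m' : ℕ) (hm : m ≤ m') :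
    partialProduct m' h t = partialProduct m h t := by
  induction m generalizing h t m' with
  | zero =>
    have h0 : t = 0 := Subtype.ext (le_antisymm (by simpa using ht) t.2.1)
    rw [h0, Path.source, Path.source]
  | succ m ih =>
    obtain ⟨m', rfl⟩ : ∃ k, m' = k + 1 := ⟨m' - 1, by omega⟩
    by_cases h2 : (t : ℝ) ≤ 1 / 2
    · rw [partialProduct_succ_of_le _ _ h2, partialProduct_succ_of_le _ _ h2]
    · rw [partialProduct_succ_of_not_le _ _ h2, partialProduct_succ_of_not_le _ _ h2]
      refine ih _ _ ?_ _ (by omega)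
      rw [pow_succ] at ht
      dsimp only
      linarith

theorem infiniteProductFun_eq (h : ℕ → Path p p) {t : I} {m : ℕ}
    (hm : ⌈1 / (1 - (t : ℝ))⌉₊ ≤ m) : infiniteProductFun h t = partialProduct m h t := by
  rcases t.2.2.lt_or_eq with h1 | h1
  · refine (partialProduct_eq_of_le _ _ _ ?_ _ hm).symm
    have h2 : 0 < 1 - (t : ℝ) := by linarith
    have h3 : (⌈1 / (1 - (t : ℝ))⌉₊ : ℝ) ≤ 2 ^ ⌈1 / (1 - (t : ℝ))⌉₊ := by
      exact_mod_cast Nat.lt_two_pow_self.le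
    calc (1 : ℝ) = (1 - t) * (1 / (1 - t)) := by field_simp
      _ ≤ _ := mul_le_mul_of_nonneg_left ((Nat.le_ceil _).trans h3) h2.le
  · have : t = 1 := Subtype.ext h1
    rw [infiniteProductFun, this, Path.target, Path.target]

theorem dist_partialProduct_base_le (m : ℕ) {h : ℕ → Path p p} {r : ℕ → ℝ}
    (H : ShrinkingLoops h r) (t : I) : dist (partialProduct m h t) p ≤ r 0 := by
  induction m generalizing h r t with
  | zero => simpa [partialProduct] using H.nonneg 0
  | succ m ih =>
    by_cases h2 : (t : ℝ) ≤ 1 / 2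
    · rw [partialProduct_succ_of_le _ _ h2]
      exact H.2.2 0 _
    · rw [partialProduct_succ_of_not_le _ _ h2]
      exact (ih H.shift _).trans (H.1 (Nat.zero_le _))

theorem dist_partialProduct_le (m : ℕ) {h : ℕ → Path p p} {r : ℕ → ℝ}
    (H : ShrinkingLoops h r) (t : I) {m' : ℕ} (hm : m ≤ m') :
    dist (partialProduct m' h t) (partialProduct m h t) ≤ r m := by
  induction m generalizing h r t m' with
  | zero => simpa [partialProduct] using dist_partialProduct_base_le m' H t
  | succ m ih =>
    obtain ⟨m', rfl⟩ : ∃ k, m' = k + 1 := ⟨m' - 1, by omega⟩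
    by_cases h2 : (t : ℝ) ≤ 1 / 2
    · rw [partialProduct_succ_of_le _ _ h2, partialProduct_succ_of_le _ _ h2, dist_self]
      exact H.nonneg _
    · rw [partialProduct_succ_of_not_le _ _ h2, partialProduct_succ_of_not_le _ _ h2]
      exact ih H.shift _ (by omega)

theorem dist_infiniteProductFun_le {h : ℕ → Path p p} {r : ℕ → ℝ}
    (H : ShrinkingLoops h r) (m : ℕ) (t : I) :
    dist (infiniteProductFun h t) (partialProduct m h t) ≤ r m := by
  rw [infiniteProductFun_eq h (le_max_left _ m)]
  exact dist_partialProduct_le m H t (le_max_right _ _)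

/-- The infinite product of a shrinking sequence of loops. -/
def infiniteProduct {h : ℕ → Path p p} {r : ℕ → ℝ} (H : ShrinkingLoops h r) : Path p p where
  toFun := infiniteProductFun h
  continuous_toFun := by
    refine TendstoUniformly.continuous (F := fun m => ⇑(partialProduct m h)) (p := atTop) ?_
      (Frequently.of_forall fun m => (partialProduct m h).continuous)
    rw [Metric.tendstoUniformly_iff]
    intro ε hε
    filter_upwards [H.2.1.eventually_lt_const hε] with m hm t
    exact (dist_infiniteProductFun_le H m t).trans_lt hm
  source' := by rw [infiniteProductFun, Path.source]
  target' := by rw [infiniteProductFun, Path.target]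

theorem infiniteProduct_eq_trans {h : ℕ → Path p p} {r : ℕ → ℝ} (H : ShrinkingLoops h r) :
    infiniteProduct H = (h 0).trans (infiniteProduct H.shift) := by
  ext t
  change infiniteProductFun h t = _
  by_cases h2 : (t : ℝ) ≤ 1 / 2
  · rw [infiniteProductFun_eq h (Nat.le_succ _), partialProduct_succ_of_le _ _ h2]
    exact (if_pos h2).symm
  · rw [Path.trans_apply, dif_neg h2]
    set t' : I := ⟨2 * t - 1, by linarith, by linarith [t.2.2]⟩
    change _ = infiniteProductFun _ t'
    rw [infiniteProductFun_eq (fun k => h (k + 1)) (le_max_right ⌈1 / (1 - (t : ℝ))⌉₊ _),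
      infiniteProductFun_eq h ((le_max_left _ ⌈1 / (1 - (t' : ℝ))⌉₊).trans (Nat.le_succ _)),
      partialProduct_succ_of_not_le _ _ h2]

/-- If two infinite products that differ in one factor only are finely homotopic, then so are the
two factors. -/
theorem FinelyHomotopic.of_infiniteProduct (n : ℕ) {h h' : ℕ → Path p p} {r r' : ℕ → ℝ}
    (H : ShrinkingLoops h r) (H' : ShrinkingLoops h' r') (hne : ∀ k, k ≠ n → h k = h' k)
    (hf : FinelyHomotopic (infiniteProduct H) (infiniteProduct H')) :
    FinelyHomotopic (h n) (h' n) := by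
  induction n generalizing h h' r r' with
  | zero =>
    have htail : infiniteProduct H.shift = infiniteProduct H'.shift := by
      ext t
      change infiniteProductFun _ t = infiniteProductFun _ t
      congr 1
      funext k
      exact hne (k + 1) (by omega)
    rw [infiniteProduct_eq_trans H, infiniteProduct_eq_trans H', htail] at hf
    exact hf.trans_right_cancel
  | succ n ih =>
    rw [infiniteProduct_eq_trans H, infiniteProduct_eq_trans H', hne 0 (by omega)] at hf
    exact ih H.shift H'.shift (fun k hk => hne (k + 1) (by omega)) hf.trans_left_cancel

/-! ### Uncountability of the fundamental group -/

theorem partialProduct_congr (m : ℕ) {h h' : ℕ → Path p p} (heq : ∀ k < m, h k = h' k) :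
    partialProduct m h = partialProduct m h' := by
  induction m generalizing h h' with
  | zero => rfl
  | succ m ih =>
    rw [partialProduct, partialProduct, heq 0 (by omega),
      ih fun k hk => heq (k + 1) (by omega)]

/-- If there are arbitrarily small loops at `p` that are not finely homotopic to the constant loop,
then the fundamental group at `p` is uncountable. The infinite products of such loops are indexed by
the Cantor space. If the fundamental group were countable, then some fine homotopy class of products
would be dense in an open set. As these classes are `Gδ` sets, the Baire theorem gives two finely
homotopic products that differ in a single factor. -/
theorem uncountable_fundamentalGroup_of_small_loops
    (hsmall : ∀ ε > 0, ∃ g : Path p p, (∀ t, dist (g t) p ≤ ε) ∧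
      ¬ FinelyHomotopic g (Path.refl p)) :
    Uncountable (FundamentalGroup Y p) := by
  have hpos : ∀ k : ℕ, (0 : ℝ) < 1 / ((k : ℝ) + 1) := fun k => Nat.one_div_pos_of_nat
  choose g hg hg' using fun k : ℕ => hsmall _ (hpos k)
  set r : ℕ → ℝ := fun k => 1 / ((k : ℝ) + 1) with hr
  have hr0 : Tendsto r atTop (𝓝 0) := tendsto_one_div_add_atTop_nhds_zero_nat
  let h : (ℕ → Bool) → ℕ → Path p p := fun y k => bif y k then g k else Path.refl p
  have H : ∀ y, ShrinkingLoops (h y) r := fun y => by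
    refine ⟨fun a b hab => Nat.one_div_le_one_div hab, hr0, fun k t => ?_⟩
    simp only [h]
    cases y k
    · simpa [hr] using (hpos k).le
    · exact hg k t
  let γ : (ℕ → Bool) → Path p p := fun y => infiniteProduct (H y)
  have hγ : ∀ y y' m, (∀ k < m, y k = y' k) → ∀ t, dist (γ y t) (γ y' t) ≤ r m + r m := by
    intro y y' m hyy t
    have h1 := dist_infiniteProductFun_le (H y) m t
    have h2 := dist_infiniteProductFun_le (H y') m t
    rw [partialProduct_congr m (h' := h y') fun k hk => by simp only [h, hyy k hk]] at h1
    exact (dist_triangle_right _ _ _).trans (add_le_add h1 h2)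
  rw [← not_countable_iff]
  intro hcount
  let D : FundamentalGroup Y p → Set (ℕ → Bool) := fun q =>
    {y | FundamentalGroup.fromPath (Path.Homotopic.Quotient.mk (γ y)) = q}
  have hcover : ⋃ q, closure (D q) = univ :=
    eq_univ_of_forall fun y => mem_iUnion.2 ⟨_, subset_closure rfl⟩
  obtain ⟨q, hq⟩ := nonempty_interior_of_iUnion_of_closed (fun q => isClosed_closure) hcover
  set V := interior (closure (D q)) with hV
  have hVo : IsOpen V := isOpen_interior
  obtain ⟨y₀, hy₀V, hy₀D⟩ : (V ∩ D q).Nonempty := by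
    obtain ⟨y, hy⟩ := hq
    exact mem_closure_iff.1 (interior_subset hy) V hVo hy
  set C : Set (ℕ → Bool) := {y | FinelyHomotopic (γ y) (γ y₀)} with hC
  have hDC : D q ⊆ C := fun y hy =>
    Path.Homotopic.finelyHomotopic (Path.Homotopic.Quotient.exact
      (show Path.Homotopic.Quotient.mk (γ y) = Path.Homotopic.Quotient.mk (γ y₀) from
        hy.trans hy₀D.symm))
  have hCG : IsGδ C := by
    have : C = ⋂ k : ℕ, {y | Relation.ReflTransGen (FineStep p (r k)) (γ y) (γ y₀)} := by
      ext y
      simp only [hC, mem_ofPred_eq, mem_iInter]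
      refine ⟨fun hy k => hy _ (hpos k), fun hy δ hδ => ?_⟩
      obtain ⟨k, hk⟩ := (hr0.eventually_lt_const hδ).exists
      refine Relation.ReflTransGen.mono (fun f f' hff => ?_) _ _ (hy k)
      exact ⟨hff.1.mono hk.le, hff.2.1.mono hk.le, fun t => (hff.2.2 t).trans hk⟩
    rw [this]
    refine IsGδ.iInter_of_isOpen fun k => isOpen_iff_mem_nhds.2 fun y hy => ?_
    -- Each class at a fixed scale is open, since nearby products are joined by a single step.
    obtain ⟨m, hm⟩ := ((hr0.add hr0).eventually_lt_const
      (show (0 : ℝ) + 0 < r k by rw [add_zero]; exact hpos k)).exists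
    have hev : ∀ᶠ y' in 𝓝 y, ∀ i ∈ Finset.range m, y' i = y i :=
      (Filter.eventually_all_finset _).2 fun i _ =>
        (continuous_apply i).continuousAt.eventually_mem ((isOpen_discrete {y i}).mem_nhds rfl)
    filter_upwards [hev] with y' hy'
    refine Relation.ReflTransGen.head ⟨(γ y').isFineLoop (hpos k), (γ y).isFineLoop (hpos k),
      fun t => ?_⟩ hy
    exact (hγ y' y m (fun i hi => hy' i (Finset.mem_range.2 hi)) t).trans_lt hm
  -- The class `C` is a dense `Gδ` in `V`; filled up outside `V` it is one in the whole space.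
  set S := C ∪ Vᶜ with hS
  have hSG : IsGδ S := hCG.union hVo.isClosed_compl.isGδ
  have hSd : Dense S := by
    intro y
    by_cases hy : y ∈ V
    · exact closure_mono (hDC.trans subset_union_left) (interior_subset hy)
    · exact subset_closure (Or.inr hy)
  let flip : ℕ → (ℕ → Bool) → (ℕ → Bool) := fun n y => Function.update y n (!y n)
  have hflip : ∀ n, Function.Involutive (flip n) := fun n y => by simp [flip]
  have hflipc : ∀ n, Continuous (flip n) := fun n =>
    continuous_id.update n ((continuous_of_discreteTopology (f := not)).comp (continuous_apply n))
  obtain ⟨n, hn⟩ : ∃ n, flip n y₀ ∈ V := by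
    have ht : Tendsto (fun n => flip n y₀) atTop (𝓝 y₀) := by
      rw [tendsto_pi_nhds]
      intro i
      refine tendsto_const_nhds.congr' ?_
      filter_upwards [eventually_gt_atTop i] with n hn
      simp [flip, Function.update_of_ne hn.ne]
    exact (ht.eventually (hVo.mem_nhds hy₀V)).exists
  let e : (ℕ → Bool) ≃ₜ (ℕ → Bool) :=
    { toEquiv := (hflip n).toPerm
      continuous_toFun := hflipc n
      continuous_invFun := hflipc n }
  have hSd' : Dense (flip n ⁻¹' S) := hSd.preimage e.isOpenMap
  have hSG' : IsGδ (flip n ⁻¹' S) := hSG.preimage (hflipc n)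
  obtain ⟨y, ⟨hyV, hyV'⟩, hyS, hyS'⟩ := (Dense.inter_of_Gδ hSG hSG' hSd hSd').inter_open_nonempty
    (V ∩ flip n ⁻¹' V) (hVo.inter (hVo.preimage (hflipc n))) ⟨y₀, hy₀V, hn⟩
  have hyC : FinelyHomotopic (γ y) (γ y₀) := hyS.resolve_right fun h => h hyV
  have hyC' : FinelyHomotopic (γ (flip n y)) (γ y₀) := hyS'.resolve_right fun h => h hyV'
  have hfin := FinelyHomotopic.of_infiniteProduct n (H y) (H (flip n y))
    (fun k hk => by simp [h, flip, Function.update_of_ne hk]) (hyC.trans hyC'.symm)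
  have e1 : flip n y n = !y n := by simp [flip]
  simp only [h, e1] at hfin
  cases hyn : y n
  · rw [hyn] at hfin
    exact hg' n hfin.symm
  · rw [hyn] at hfin
    exact hg' n hfin
end fine

/-! ### Small essential loops in asymptotic cones -/

/-- The chain behind a fine homotopy at scale `δ`, listed with at least one step. -/
theorem exists_chain_of_reflTransGen_fineStep {Y : Type*} [MetricSpace Y] {p : Y} {δ : ℝ}
    (hδ : 0 < δ) {f g : unitInterval → Y} (hf : IsFineLoop p δ f)
    (h : Relation.ReflTransGen (FineStep p δ) f g) :
    ∃ (N : ℕ) (c : ℕ → unitInterval → Y), 0 < N ∧ c 0 = f ∧ c N = g ∧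
      (∀ j ≤ N, IsFineLoop p δ (c j)) ∧ ∀ j < N, ∀ t, dist (c j t) (c (j + 1) t) < δ := by
  induction h with
  | refl => exact ⟨1, fun _ => f, one_pos, rfl, rfl, fun _ _ => hf, fun _ _ _ => by simpa using hδ⟩
  | @tail g g' _ hstep ih =>
    obtain ⟨N, c, hN, h0, hcN, hc, hd⟩ := ih
    refine ⟨N + 1, fun j => if j ≤ N then c j else g', by omega, by simp [h0], by simp, ?_, ?_⟩
    · intro j hj
      dsimp only
      split_ifs with h
      · exact hc j h
      · exact hstep.2.1
    · intro j hj t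
      dsimp only
      rw [if_pos (by omega)]
      split_ifs with h
      · exact hd j (by omega) t
      · have : j = N := by omega
        rw [this, hcN]
        exact hstep.2.2 t

/-- In a homogeneous space the loop of `exists_lipschitz_param_partitionNumber_le` can be moved by
an isometry to any base point. -/
theorem exists_based_param_partitionNumber_le {X : Type*} [MetricSpace X]
    (hgeod : IsGeodesicSpace X) (hhom : IsHomogeneousSpace X) (α : C(Circle, X)) {L : ℝ}
    (hα : loopLength α = ENNReal.ofReal L) (hL : 0 < L) (x : X) :
    ∃ b : ℝ → X, b 0 = x ∧ b 1 = x ∧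
      (∀ s ∈ Icc (0 : ℝ) 1, ∀ t ∈ Icc (0 : ℝ) 1, dist (b s) (b t) ≤ 2 * L * |s - t|) ∧
      ∀ (M N : ℕ) (f : ℕ → ℕ → X) (r : ℝ), 0 < M → 0 < N → 2 * L / M ≤ r → 8 * r < L →
        (∀ i ≤ M, f i 0 = b (i / M)) → (∀ i ≤ M, f i N = x) →
        (∀ j ≤ N, f 0 j = x) → (∀ j ≤ N, f M j = x) →
        (∀ i < M, ∀ j ≤ N, dist (f i j) (f (i + 1) j) ≤ r) →
        (∀ i ≤ M, ∀ j < N, dist (f i j) (f i (j + 1)) ≤ r) →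
        partitionNumber α (loopLength α / 2) ≤ (M * N : ℕ) := by
  obtain ⟨β, h0, h1, hl, hfill⟩ := exists_lipschitz_param_partitionNumber_le hgeod α hα hL
  obtain ⟨φ, hφ⟩ := hhom (α 1) x
  refine ⟨fun s => φ (β (2 * L * s)), by simp [h0, hφ], by simp [h1, hφ], ?_, ?_⟩
  · intro s hs t ht
    have key : ∀ s ∈ Icc (0 : ℝ) 1, 2 * L * s ∈ Icc 0 (2 * L) := fun s hs =>
      ⟨mul_nonneg (by linarith) hs.1, mul_le_of_le_one_right (by linarith) hs.2⟩
    rw [φ.dist_eq]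
    refine (hl _ (key s hs) _ (key t ht)).trans_eq ?_
    rw [← mul_sub, abs_mul, abs_of_pos (by linarith : 0 < 2 * L)]
  · intro M N f r hM hN hMr hr hf0 hfN h0j hMj hh hv
    have hx : φ.symm x = α 1 := by rw [← hφ, φ.symm_apply_apply]
    refine hfill M N (fun i j => φ.symm (f i j)) r hM hN hMr hr ?_ ?_ ?_ ?_ ?_ ?_
    · intro i hi; rw [hf0 i hi, φ.symm_apply_apply]
    · intro i hi; rw [hfN i hi, hx]
    · intro j hj; rw [h0j j hj, hx]
    · intro j hj; rw [hMj j hj, hx]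
    · intro i hi j hj; rw [φ.symm.dist_eq]; exact hh i hi j hj
    · intro i hi j hj; rw [φ.symm.dist_eq]; exact hv i hi j hj

theorem ScalingSequence.eventually_ge {ω : Ultrafilter ℕ} (d : ScalingSequence ω) (K : ℕ) :
    ∀ᶠ n in (ω : Filter ℕ), K ≤ n := by
  filter_upwards [d.diverges (∑ k ∈ Finset.range K, d.toFun k)] with n hn
  by_contra h
  push Not at h
  exact absurd hn (not_lt.2
    (Finset.single_le_sum (fun k _ => (d.pos k).le) (Finset.mem_range.2 h)))

/-- A space that is not `ε`-coarsely loop divisible contains loops of length comparable to `d n`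
that need, as `n` tends to infinity along `ω`, more and more pieces. -/
theorem exists_loops_of_not_isCoarselyLoopDivisible {X : Type*} [MetricSpace X] [Nonempty X]
    {ω : Ultrafilter ℕ} {d : ScalingSequence ω} {ε : ℝ}
    (h : ¬ IsCoarselyLoopDivisible X ω d ε) :
    ∃ δ > 0, ∃ (α : ℕ → C(Circle, X)) (L : ℕ → ℝ), ∀ K : ℕ, ∀ᶠ n in (ω : Filter ℕ),
      loopLength (α n) = ENNReal.ofReal (L n) ∧ δ * d.toFun n ≤ L n ∧ L n ≤ ε * d.toFun n ∧
      (K : ℕ∞) < partitionNumber (α n) (loopLength (α n) / 2) := by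
  classical
  unfold IsCoarselyLoopDivisible at h
  push Not at h
  obtain ⟨δ, hδ, hδε, h⟩ := h
  set Q : ℕ → ℕ → Prop := fun n K => ∃ (α : C(Circle, X)) (m : ℕ), δ * d.toFun n ≤ m ∧
    (m : ℝ) ≤ ε * d.toFun n ∧ (m : ℝ≥0∞) < loopLength α + 1 ∧ loopLength α ≤ m ∧
    (K : ℕ∞) < partitionNumber α (loopLength α / 2) with hQ
  have hQω : ∀ K, ∀ᶠ n in (ω : Filter ℕ), Q n K := by
    intro K
    by_contra hK
    obtain ⟨n, hn, m, h1, h2, h3⟩ := h {n | ¬ Q n K} (Ultrafilter.eventually_not.2 hK) K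
    refine hn ?_
    simp only [divisibility, lt_iSup_iff] at h3
    obtain ⟨α, ⟨h4, h5⟩, h6⟩ := h3
    exact ⟨α, m, h1, h2, h4, h5, h6⟩
  -- The greatest `K ≤ n` that is attained tends to infinity along `ω`.
  have hsel : ∀ n, ∃ α : C(Circle, X), ∃ m : ℕ, ∀ K ≤ n, Q n K →
      δ * d.toFun n ≤ m ∧ (m : ℝ) ≤ ε * d.toFun n ∧ (m : ℝ≥0∞) < loopLength α + 1 ∧
      loopLength α ≤ m ∧ (K : ℕ∞) < partitionNumber α (loopLength α / 2) := by
    intro n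
    by_cases hn : ∃ K ≤ n, Q n K
    · obtain ⟨K₀, hK₀, hQ₀⟩ := hn
      obtain ⟨α, m, h1, h2, h3, h4, h5⟩ := Nat.findGreatest_spec (P := Q n) hK₀ hQ₀
      refine ⟨α, m, fun K hK hQK => ⟨h1, h2, h3, h4, lt_of_le_of_lt ?_ h5⟩⟩
      exact_mod_cast Nat.le_findGreatest hK hQK
    · exact ⟨ContinuousMap.const _ (Classical.arbitrary X), 0, fun K hK hQK => absurd ⟨K, hK, hQK⟩ hn⟩
  choose α m hαm using hsel
  -- Passing from `m - 1 < |α|` to a multiple of `d n` costs a factor of two when `2 < δ * d n`.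
  refine ⟨δ / 2, by positivity, α, fun n => (loopLength (α n)).toReal, fun K => ?_⟩
  filter_upwards [hQω K, d.eventually_ge K, d.diverges (2 / δ)] with n hn hKn hdn
  obtain ⟨h1, h2, h3, h4, h5⟩ := hαm n K hKn hn
  have hfin : loopLength (α n) ≠ ⊤ := ne_top_of_le_ne_top (ENNReal.natCast_ne_top _) h4
  have h6 : (m n : ℝ) < (loopLength (α n)).toReal + 1 := by
    have := (ENNReal.toReal_lt_toReal (ENNReal.natCast_ne_top _)
      (ENNReal.add_ne_top.2 ⟨hfin, ENNReal.one_ne_top⟩)).2 h3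
    rwa [ENNReal.toReal_natCast, ENNReal.toReal_add hfin ENNReal.one_ne_top,
      ENNReal.toReal_one] at this
  have h7 : (loopLength (α n)).toReal ≤ m n := by
    have := ENNReal.toReal_mono (ENNReal.natCast_ne_top _) h4
    rwa [ENNReal.toReal_natCast] at this
  rw [div_lt_iff₀ hδ] at hdn
  exact ⟨(ENNReal.ofReal_toReal hfin).symm, by linarith, by linarith, h5⟩

/-- Strict bounds on distances in the cone hold for the rescaled distances of representing sequences,
`ω`-almost always. -/
theorem eventually_dist_le_of_dist_mk_lt {X : Type*} [MetricSpace X] {ω : Ultrafilter ℕ}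
    {d : ScalingSequence ω} {e : ℕ → X} {x y : ConeSequence ω d e} {δ : ℝ}
    (h : dist (SeparationQuotient.mk x) (SeparationQuotient.mk y) < δ) :
    ∀ᶠ n in (ω : Filter ℕ), dist (x.1 n) (y.1 n) ≤ δ * d.toFun n := by
  rw [SeparationQuotient.dist_mk] at h
  filter_upwards [(ConeSequence.tendsto_coneDist x y).eventually_lt_const h] with n hn
  exact ((div_lt_iff₀ (d.pos n)).1 hn).le

/-- Near every point of the asymptotic cone there is a loop that is not finely homotopic to a
constant. It is the limit of loops in the space that need more and more pieces; a fine homotopy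
would give grids in the cone, hence grids of a fixed size in the space for `ω`-almost all `n`, and
so bound the number of pieces. -/
theorem exists_small_loop_not_finelyHomotopic {X : Type*} [MetricSpace X]
    (hgeod : IsGeodesicSpace X) (hhom : IsHomogeneousSpace X)
    (ω : Ultrafilter ℕ) (d : ScalingSequence ω) (e : ℕ → X) {ε : ℝ}
    (hdiv : ¬ IsCoarselyLoopDivisible X ω d ε) (p : AsymptoticCone ω d e) (hε : 0 < ε) :
    ∃ g : Path p p, (∀ t, dist (g t) p ≤ 2 * ε) ∧ ¬ FinelyHomotopic g (Path.refl p) := by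
  have : Nonempty X := ⟨e 0⟩
  obtain ⟨x, rfl⟩ := SeparationQuotient.surjective_mk p
  obtain ⟨δ₀, hδ₀, α, L, hα⟩ := exists_loops_of_not_isCoarselyLoopDivisible hdiv
  have hb : ∀ n, ∃ b : ℝ → X, b 0 = x.1 n ∧ b 1 = x.1 n ∧
      (∀ s ∈ Icc (0 : ℝ) 1, ∀ t ∈ Icc (0 : ℝ) 1,
        dist (b s) (b t) ≤ 2 * ε * |s - t| * d.toFun n) ∧
      (loopLength (α n) = ENNReal.ofReal (L n) → 0 < L n → L n ≤ ε * d.toFun n →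
        ∀ (M N : ℕ) (f : ℕ → ℕ → X) (r : ℝ), 0 < M → 0 < N → 2 * L n / M ≤ r → 8 * r < L n →
        (∀ i ≤ M, f i 0 = b (i / M)) → (∀ i ≤ M, f i N = x.1 n) →
        (∀ j ≤ N, f 0 j = x.1 n) → (∀ j ≤ N, f M j = x.1 n) →
        (∀ i < M, ∀ j ≤ N, dist (f i j) (f (i + 1) j) ≤ r) →
        (∀ i ≤ M, ∀ j < N, dist (f i j) (f i (j + 1)) ≤ r) →
        partitionNumber (α n) (loopLength (α n) / 2) ≤ (M * N : ℕ)) := by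
    intro n
    by_cases hn : loopLength (α n) = ENNReal.ofReal (L n) ∧ 0 < L n ∧ L n ≤ ε * d.toFun n
    · obtain ⟨b, h0, h1, hl, hf⟩ :=
        exists_based_param_partitionNumber_le hgeod hhom (α n) hn.1 hn.2.1 (x.1 n)
      refine ⟨b, h0, h1, fun s hs t ht => (hl s hs t ht).trans ?_, fun _ _ _ => hf⟩
      have := mul_le_mul_of_nonneg_right hn.2.2 (abs_nonneg (s - t))
      linarith
    · refine ⟨fun _ => x.1 n, rfl, rfl, fun s _ t _ => ?_, fun h1 h2 h3 => absurd ⟨h1, h2, h3⟩ hn⟩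
      rw [dist_self]
      have := d.pos n
      positivity
  choose b hb0 hb1 hbl hbf using hb
  let s : unitInterval → ConeSequence ω d e := fun t => ⟨fun n => b n t, by
    obtain ⟨M, hM⟩ := x.2
    refine ⟨2 * ε + M, ?_⟩
    filter_upwards [hM] with n hn
    have h1 := hbl n t t.2 0 (by simp)
    rw [hb0, sub_zero, abs_of_nonneg t.2.1] at h1
    have h2 : dist (b n t) (x.1 n) / d.toFun n ≤ 2 * ε := by
      rw [div_le_iff₀ (d.pos n)]
      exact h1.trans (mul_le_mul_of_nonneg_right (mul_le_of_le_one_right (by positivity) t.2.2)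
        (d.pos n).le)
    have h3 : dist (b n t) (e n) / d.toFun n ≤
        dist (b n t) (x.1 n) / d.toFun n + dist (x.1 n) (e n) / d.toFun n := by
      rw [← add_div]
      have := d.pos n
      gcongr
      exact dist_triangle _ _ _
    linarith⟩
  have hsl : ∀ t t' : unitInterval, dist (SeparationQuotient.mk (s t)) (SeparationQuotient.mk (s t'))
      ≤ 2 * ε * |(t : ℝ) - t'| := by
    intro t t'
    rw [SeparationQuotient.dist_mk]
    refine le_of_tendsto (ConeSequence.tendsto_coneDist (s t) (s t')) (Eventually.of_forall fun n => ?_)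
    rw [div_le_iff₀ (d.pos n)]
    exact hbl n t t.2 t' t'.2
  have hs0 : s 0 = x := Subtype.ext (funext fun n => hb0 n)
  have hs1 : s 1 = x := Subtype.ext (funext fun n => hb1 n)
  let g : Path (SeparationQuotient.mk x) (SeparationQuotient.mk x) :=
    { toFun := fun t => SeparationQuotient.mk (s t)
      continuous_toFun := (LipschitzWith.of_dist_le_mul (K := (2 * ε).toNNReal) fun t t' => by
        rw [Real.coe_toNNReal _ (by positivity)]; exact hsl t t').continuous
      source' := by rw [hs0]
      target' := by rw [hs1] }
  refine ⟨g, fun t => ?_, fun hfine => ?_⟩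
  · have h1 := hsl t 0
    rw [hs0] at h1
    refine h1.trans (mul_le_of_le_one_right (by positivity) ?_)
    rw [Set.Icc.coe_zero, sub_zero, abs_of_nonneg t.2.1]
    exact t.2.2
  -- A grid of mesh `δ₀ / 32` has cells of perimeter at most `δ₀ / 8`, well below half of the length
  -- of the loops.
  set δ := δ₀ / 32 with hδ
  have hδ0 : 0 < δ := by positivity
  obtain ⟨N, c, hN, hc0, hcN, hcl, hcd⟩ :=
    exists_chain_of_reflTransGen_fineStep hδ0 (g.isFineLoop hδ0) (hfine δ hδ0)
  let pt : ℕ → ℕ → unitInterval := fun M i => projIcc 0 1 zero_le_one ((i : ℝ) / M)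
  have hMex : ∀ᶠ M : ℕ in atTop, 0 < M ∧ 2 * ε / M ≤ δ ∧ ∀ j ∈ Finset.range (N + 1), ∀ i,
      dist (c j (pt M i)) (c j (pt M (i + 1))) < δ := by
    refine (eventually_gt_atTop 0).and (Eventually.and ?_ ?_)
    · exact ((tendsto_const_div_atTop_nhds_zero_nat (2 * ε)).eventually_lt_const hδ0).mono
        fun _ h => h.le
    · rw [Filter.eventually_all_finset]
      intro j hj
      obtain ⟨-, -, η, hη, hcη⟩ := hcl j (by simpa [Nat.lt_succ_iff] using hj)
      filter_upwards [(tendsto_const_div_atTop_nhds_zero_nat (1 : ℝ)).eventually_lt_const hη]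
        with M hM i
      refine hcη _ _ (lt_of_le_of_lt ?_ hM)
      have h1 := (LipschitzWith.projIcc (zero_le_one (α := ℝ))).dist_le_mul ((i : ℝ) / M)
        (((i + 1 : ℕ) : ℝ) / M)
      refine h1.trans_eq ?_
      rw [Real.dist_eq, ← sub_div, abs_div, Nat.cast_succ, abs_of_nonneg (Nat.cast_nonneg (α := ℝ) M)]
      simp
  obtain ⟨M, hM, hMδ, hMc⟩ := hMex.exists
  have hM' : (0 : ℝ) < M := by exact_mod_cast hM
  have hpt : ∀ i ≤ M, (pt M i : ℝ) = i / M := fun i hi => by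
    have hmem : (i : ℝ) / M ∈ Icc (0 : ℝ) 1 :=
      ⟨by positivity, (div_le_one hM').2 (by exact_mod_cast hi)⟩
    simp only [pt, projIcc_of_mem _ hmem]
  have hpt0 : pt M 0 = 0 := Subtype.ext (by rw [hpt 0 (Nat.zero_le _)]; simp)
  have hptM : pt M M = 1 := Subtype.ext (by rw [hpt M le_rfl]; simp [hM'.ne'])
  classical
  -- Representing sequences of the grid points, exact on the boundary of the grid.
  let R : ℕ → ℕ → ConeSequence ω d e := fun i j =>
    if j = 0 then s (pt M i) else if i = 0 ∨ i = M ∨ j = N then x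
    else Function.surjInv SeparationQuotient.surjective_mk (c j (pt M i))
  have hR0 : ∀ i, R i 0 = s (pt M i) := fun i => if_pos rfl
  have hRx : ∀ i j, j ≠ 0 → (i = 0 ∨ i = M ∨ j = N) → R i j = x := fun i j hj h =>
    (if_neg hj).trans (if_pos h)
  have hR : ∀ i, ∀ j ≤ N, SeparationQuotient.mk (R i j) = c j (pt M i) := by
    intro i j hj
    simp only [R]
    split_ifs with h1 h2
    · rw [h1, hc0]; rfl
    · rcases h2 with h2 | h2 | h2
      · rw [h2, hpt0, (hcl j hj).1]
      · rw [h2, hptM, (hcl j hj).2.1]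
      · rw [h2, hcN]; rfl
    · exact Function.surjInv_eq _ _
  have hh : ∀ᶠ n in (ω : Filter ℕ), ∀ i ∈ Finset.range M, ∀ j ∈ Finset.range (N + 1),
      dist ((R i j).1 n) ((R (i + 1) j).1 n) ≤ δ * d.toFun n := by
    rw [Filter.eventually_all_finset]
    intro i hi
    rw [Filter.eventually_all_finset]
    intro j hj
    have hjN : j ≤ N := by simpa [Nat.lt_succ_iff] using hj
    refine eventually_dist_le_of_dist_mk_lt ?_
    rw [hR i j hjN, hR (i + 1) j hjN]
    exact hMc j hj i
  have hv : ∀ᶠ n in (ω : Filter ℕ), ∀ i ∈ Finset.range (M + 1), ∀ j ∈ Finset.range N,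
      dist ((R i j).1 n) ((R i (j + 1)).1 n) ≤ δ * d.toFun n := by
    rw [Filter.eventually_all_finset]
    intro i hi
    rw [Filter.eventually_all_finset]
    intro j hj
    have hjN : j < N := by simpa using hj
    refine eventually_dist_le_of_dist_mk_lt ?_
    rw [hR i j hjN.le, hR i (j + 1) hjN]
    exact hcd j hjN _
  obtain ⟨n, ⟨hn1, hn2, hn3, hn4⟩, hhn, hvn⟩ := ((hα (M * N)).and (hh.and hv)).exists
  have hdn := d.pos n
  have hLn : 0 < L n := lt_of_lt_of_le (by positivity) hn2
  refine absurd (hbf n hn1 hLn hn3 M N (fun i j => (R i j).1 n) (δ * d.toFun n) hM hN ?_ ?_ ?_ ?_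
    ?_ ?_ ?_ ?_) (not_le.2 hn4)
  · calc 2 * L n / M ≤ 2 * (ε * d.toFun n) / M := by gcongr
      _ = 2 * ε / M * d.toFun n := by ring
      _ ≤ δ * d.toFun n := by gcongr
  · have : 0 < δ₀ * d.toFun n := by positivity
    rw [hδ]; linarith
  · intro i hi
    rw [hR0]
    simp only [s, hpt i hi]
  · intro i _
    rw [hRx i N hN.ne' (by simp)]
  · intro j _
    rcases eq_or_ne j 0 with rfl | hj
    · rw [hR0, hpt0, hs0]
    · rw [hRx 0 j hj (by simp)]
  · intro j _
    rcases eq_or_ne j 0 with rfl | hj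
    · rw [hR0, hptM, hs1]
    · rw [hRx M j hj (by simp)]
  · intro i hi j hj
    exact hhn i (Finset.mem_range.2 hi) j (Finset.mem_range.2 (by omega))
  · intro i hi j hj
    exact hvn i (Finset.mem_range.2 (by omega)) j (Finset.mem_range.2 hj)
end

theorem mainTheorem1 {X : Type*} [MetricSpace X] [CompleteSpace X]
    (hgeod : IsGeodesicSpace X) (hhom : IsHomogeneousSpace X)
    (ω : Ultrafilter ℕ) (d : ScalingSequence ω) (e : ℕ → X)
    (hdiv : ∀ ε : ℝ, 0 < ε → ¬ IsCoarselyLoopDivisible X ω d ε)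
    (p : AsymptoticCone ω d e) :
    Uncountable (FundamentalGroup (AsymptoticCone ω d e) p) := by
  refine uncountable_fundamentalGroup_of_small_loops fun ε hε => ?_
  obtain ⟨g, hg, hg'⟩ := exists_small_loop_not_finelyHomotopic hgeod hhom ω d e
    (hdiv (ε / 2) (by positivity)) p (by positivity)
  exact ⟨g, fun t => (hg t).trans_eq (by ring), hg'⟩
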